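/- Let $X_1,X_2,\dots$ be i.i.d. Rademacher random variables, i.e. $P(X_i=1)=P(X_i=-1)=1/2$, and put $S_n=\sum_{i=1}^n X_i$, $V_n=\big(\sum_{i=1}^n X_i^2\big)^{1/2}$. Let $\Phi$ be the standard normal distribution function, and let $(x_n)_{n\ge 1}$ be any sequence of nonnegative real numbers. (a) If $x_n=o(n^{1/2})$, then, as $n\to\infty$, $$\frac{P(S_n/V_n>x_n)}{1-\Phi(x_n)}=\exp\Big(-\frac{x_n^4}{12n}(1+o(1))\Big)(1+o(1)),\qquad \frac{P(S_n/V_n<-x_n)}{\Phi(-x_n)}=\exp\Big(-\frac{x_n^4}{12n}(1+o(1))\Big)(1+o(1)).$$ (b) The relation $$\frac{P(S_n/V_n>x_n)}{1-\Phi(x_n)}=1+o(1),\qquad \frac{P(S_n/V_n<-x_n)}{\Phi(-x_n)}=1+o(1)\qquad(n\to\infty)$$ holds if and only if $x_n=o(n^{1/4})$. Moreover, each of these two asymptotic equalities taken alone also holds if and only if $x_n=o(n^{1/4})$. -/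

import Mathlib

open MeasureTheory ProbabilityTheory Filter Topology Asymptotics

/-- The distribution function `Φ` of the standard normal law. -/
noncomputable def stdNormalCDF (x : ℝ) : ℝ := cdf (gaussianReal 0 1) x

/-- `X` is a Rademacher random variable: `P(X = 1) = P(X = -1) = 1/2`. -/
def IsRademacher {Ω : Type*} [MeasurableSpace Ω] (X : Ω → ℝ) (P : Measure Ω) : Prop :=
  Measurable X ∧ P {ω | X ω = 1} = 1 / 2 ∧ P {ω | X ω = -1} = 1 / 2

/-- `S_n = X_1 + ⋯ + X_n` (the sequence is indexed from `0`). -/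
def partialSum {Ω : Type*} (X : ℕ → Ω → ℝ) (n : ℕ) (ω : Ω) : ℝ :=
  ∑ i ∈ Finset.range n, X i ω

/-- `V_n`, the nonnegative square root of `X_1 ^ 2 + ⋯ + X_n ^ 2`. -/
noncomputable def selfNormalizer {Ω : Type*} (X : ℕ → Ω → ℝ) (n : ℕ) (ω : Ω) : ℝ :=
  √(∑ i ∈ Finset.range n, X i ω ^ 2)

/-- The relative upper tail `P(S_n / V_n > x) / (1 - Φ(x))`. -/
noncomputable def upperTailRatio {Ω : Type*} [MeasurableSpace Ω] (X : ℕ → Ω → ℝ) (P : Measure Ω)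
    (n : ℕ) (x : ℝ) : ℝ :=
  P.real {ω | partialSum X n ω / selfNormalizer X n ω > x} / (1 - stdNormalCDF x)

/-- The relative lower tail `P(S_n / V_n < -x) / Φ(-x)`. -/
noncomputable def lowerTailRatio {Ω : Type*} [MeasurableSpace Ω] (X : ℕ → Ω → ℝ) (P : Measure Ω)
    (n : ℕ) (x : ℝ) : ℝ :=
  P.real {ω | partialSum X n ω / selfNormalizer X n ω < -x} / stdNormalCDF (-x)

/-- The self-normalized moderate deviation relation along `x = x_n`:
both relative tails are `1 + o(1)` as `n → ∞`. -/
def SelfNormalizedModerateDeviation {Ω : Type*} [MeasurableSpace Ω] (X : ℕ → Ω → ℝ)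
    (P : Measure Ω) (x : ℕ → ℝ) : Prop :=
  Tendsto (fun n => upperTailRatio X P n (x n)) atTop (𝓝 1) ∧
    Tendsto (fun n => lowerTailRatio X P n (x n)) atTop (𝓝 1)

/-! Since `X i ^ 2 = 1` almost surely, `V_n = √n`, and both ratios reduce to a symmetric binomial
tail over a Gaussian tail (`binomRatio`); the lower tail is the upper tail of `-X`.

Let `a` be the first index of the tail sum at level `x √n`, `k = 2a - n` and `I = rateFun`.
Successive binomial coefficients have ratio `(1 - s) / (1 + s) ≈ exp (-2s)`, so the terms beyond `a`
follow a discretized Gaussian, and the tail is asymptotically (weight at `a`) · `(√n / 2)` · `mills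
x` (`tendsto_binomTail_div_headWeight`). Stirling makes the weight at `a` asymptotic to `√(2 / (π
n)) exp (-n I(k / n))` (`tendsto_headWeight`). As `1 - Φ(x) = (2π)^(-1/2) exp (-x² / 2) mills x`,
the Mills ratios and constants cancel, leaving `exp (x² / 2 - n I(k / n))`. The expansion `I(t) = t²
/ 2 + t⁴ / 12 + O(t⁶)` gives (a); rounding `x √n` up to `k` costs only `o(1)` in the exponent
(`exists_rate_expansion`).

For (b), a union of Chernoff bounds shows that a ratio tending to 1 forces `x = o(√n)`
(`tendsto_div_sqrt_of_binomRatio`). Then (a) applies, and its exponential tends to 1 exactly when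
`x⁴ / n → 0`. -/

/-! ### Reduction to binomial tails -/

/-- The upper tail `P(2 B - n > y)` for a binomial `B` with parameters `n` and `1/2`. -/
noncomputable def binomTail (n : ℕ) (y : ℝ) : ℝ :=
  ∑ a ∈ Finset.range (n + 1), if y < 2 * (a : ℝ) - n then (n.choose a : ℝ) / 2 ^ n else 0

/-- Pascal's rule, matching the effect of conditioning on the last step of the walk. -/
lemma binomTail_succ (n : ℕ) (y : ℝ) :
    binomTail (n + 1) y = (binomTail n (y - 1) + binomTail n (y + 1)) / 2 := by
  have h := Finset.sum_choose_succ_mul (R := ℝ)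
    (fun a b => if y < (a : ℝ) - b then (1 : ℝ) / 2 ^ (n + 1) else 0) n
  have e1 : binomTail (n + 1) y = ∑ i ∈ Finset.range (n + 2), ((n + 1).choose i : ℝ) *
      (if y < (i : ℝ) - (n + 1 - i : ℕ) then (1 : ℝ) / 2 ^ (n + 1) else 0) := by
    refine Finset.sum_congr rfl fun i hi => ?_
    have hi' : i ≤ n + 1 := Nat.lt_succ_iff.mp (Finset.mem_range.mp hi)
    rw [Nat.cast_sub hi']
    have : 2 * (i : ℝ) - (n + 1 : ℕ) = i - ((n + 1 : ℕ) - i) := by ring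
    rw [this]
    split_ifs <;> ring
  rw [e1, h, add_comm (binomTail n (y - 1)), add_div, binomTail, binomTail, Finset.sum_div,
    Finset.sum_div]
  congr 1 <;> refine Finset.sum_congr rfl fun i hi => ?_
  · have hi' : i ≤ n := Nat.lt_succ_iff.mp (Finset.mem_range.mp hi)
    rw [Nat.cast_sub (by omega)]
    have : (y < (i : ℝ) - ((n + 1 : ℕ) - i)) ↔ (y + 1 < 2 * (i : ℝ) - n) := by
      push_cast; constructor <;> intro h <;> linarith
    simp only [this]
    split_ifs <;> field_simp <;> ring
  · have hi' : i ≤ n := Nat.lt_succ_iff.mp (Finset.mem_range.mp hi)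
    rw [Nat.cast_sub (by omega)]
    have : (y < ((i + 1 : ℕ) : ℝ) - ((n : ℕ) - i)) ↔ (y - 1 < 2 * (i : ℝ) - n) := by
      push_cast; constructor <;> intro h <;> linarith
    simp only [this]
    split_ifs <;> field_simp <;> ring

section Law

variable {Ω : Type*} [MeasurableSpace Ω] {P : Measure Ω} {X : ℕ → Ω → ℝ}

lemma IsRademacher.ae_eq [IsProbabilityMeasure P] {Y : Ω → ℝ} (h : IsRademacher Y P) :
    ∀ᵐ ω ∂P, Y ω = 1 ∨ Y ω = -1 := by
  obtain ⟨hm, h1, h2⟩ := h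
  have hs1 : MeasurableSet {ω | Y ω = 1} := hm (measurableSet_singleton 1)
  have hs2 : MeasurableSet {ω | Y ω = -1} := hm (measurableSet_singleton (-1))
  have hd : Disjoint {ω | Y ω = 1} {ω | Y ω = -1} := by
    rw [Set.disjoint_left]
    intro ω h1 h2
    simp only [Set.mem_ofPred_eq] at h1 h2
    linarith
  have hu := measure_union (μ := P) hd hs2
  rw [h1, h2, ENNReal.add_halves] at hu
  have := (prob_compl_eq_zero_iff (μ := P) (hs1.union hs2)).mpr hu
  rw [ae_iff]
  convert this using 2
  ext ω
  simp

lemma IsRademacher.neg {Y : Ω → ℝ} (h : IsRademacher Y P) :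
    IsRademacher (fun ω => -Y ω) P := by
  refine ⟨h.1.neg, ?_, ?_⟩
  · simpa [neg_eq_iff_eq_neg] using h.2.2
  · simpa using h.2.1

lemma measurable_partialSum (hX : ∀ i, Measurable (X i)) (n : ℕ) : Measurable (partialSum X n) :=
  Finset.measurable_sum _ fun i _ => hX i

lemma measureReal_partialSum_gt [IsProbabilityMeasure P] (hRad : ∀ i, IsRademacher (X i) P)
    (hInd : iIndepFun X P) (n : ℕ) (y : ℝ) :
    P.real {ω | y < partialSum X n ω} = binomTail n y := by
  induction n generalizing y with
  | zero =>
    by_cases h : y < 0 <;> simp [partialSum, binomTail, h]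
  | succ n ih =>
    have hS := measurable_partialSum (fun i => (hRad i).1) n
    have hI : IndepFun (partialSum X n) (X n) P := by
      have := hInd.indepFun_finsetSum_of_notMem (fun i => (hRad i).1)
        (s := Finset.range n) (i := n) (by simp)
      convert this using 1
      ext ω
      simp [partialSum]
    have hmeas : ∀ z, MeasurableSet {ω | z < partialSum X n ω} := fun z =>
      measurableSet_lt measurable_const hS
    have hprod : ∀ z c : ℝ, P {ω | X n ω = c} = 1 / 2 →
        P.real ({ω | z < partialSum X n ω} ∩ {ω | X n ω = c}) = binomTail n z / 2 := by
      intro z c hc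
      have := hI.measure_inter_preimage_eq_mul (Set.Ioi z) {c} measurableSet_Ioi
        (measurableSet_singleton c)
      have h2 : P.real ({ω | z < partialSum X n ω} ∩ {ω | X n ω = c}) =
          P.real {ω | z < partialSum X n ω} * P.real {ω | X n ω = c} := by
        simp only [Measure.real]
        rw [← ENNReal.toReal_mul]
        exact congrArg _ this
      rw [h2, ih, measureReal_def, hc]
      simp [div_eq_mul_inv]
    -- Split on the value of the last step; the two pieces are disjoint and each factors by
    -- independence.
    have hae : {ω | y < partialSum X (n + 1) ω} =ᵐ[P]
        (({ω | y - 1 < partialSum X n ω} ∩ {ω | X n ω = 1}) ∪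
          ({ω | y + 1 < partialSum X n ω} ∩ {ω | X n ω = -1}) : Set Ω) := by
      filter_upwards [(hRad n).ae_eq] with ω hω
      apply propext
      change y < partialSum X (n + 1) ω ↔ ((y - 1 < partialSum X n ω ∧ X n ω = 1) ∨
        (y + 1 < partialSum X n ω ∧ X n ω = -1))
      have : partialSum X (n + 1) ω = partialSum X n ω + X n ω := by
        simp [partialSum, Finset.sum_range_succ]
      rw [this]
      rcases hω with h | h <;> rw [h] <;> norm_num
      exact ⟨fun h => by linarith, fun h => by linarith⟩
    rw [measureReal_congr hae, measureReal_union, hprod _ _ (hRad n).2.1, hprod _ _ (hRad n).2.2,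
      binomTail_succ]
    · ring
    · rw [Set.disjoint_left]
      rintro ω ⟨-, h1⟩ ⟨-, h2⟩
      simp only [Set.mem_ofPred_eq] at h1 h2
      linarith
    · exact (hmeas _).inter ((hRad n).1 (measurableSet_singleton _))

lemma ae_selfNormalizer_eq [IsProbabilityMeasure P] (hRad : ∀ i, IsRademacher (X i) P) (n : ℕ) :
    ∀ᵐ ω ∂P, selfNormalizer X n ω = √n := by
  have : ∀ᵐ ω ∂P, ∀ i, X i ω = 1 ∨ X i ω = -1 := ae_all_iff.mpr fun i => (hRad i).ae_eq
  filter_upwards [this] with ω hω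
  have h : ∀ i, X i ω ^ 2 = 1 := fun i => by rcases hω i with h | h <;> rw [h] <;> norm_num
  simp [selfNormalizer, h]

lemma upperTailRatio_eq [IsProbabilityMeasure P] (hRad : ∀ i, IsRademacher (X i) P)
    (hInd : iIndepFun X P) {n : ℕ} (hn : 1 ≤ n) (x : ℝ) :
    upperTailRatio X P n x = binomTail n (x * √n) / (1 - stdNormalCDF x) := by
  rw [upperTailRatio, ← measureReal_partialSum_gt hRad hInd]
  congr 1
  apply measureReal_congr
  filter_upwards [ae_selfNormalizer_eq hRad n] with ω hω
  apply propext
  change partialSum X n ω / selfNormalizer X n ω > x ↔ x * √n < partialSum X n ω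
  rw [hω, gt_iff_lt, lt_div_iff₀ (Real.sqrt_pos.mpr (by exact_mod_cast hn))]

lemma stdNormalCDF_neg (x : ℝ) : stdNormalCDF (-x) = 1 - stdNormalCDF x := by
  have h1 : (gaussianReal 0 1).real (Set.Iic (-x)) = (gaussianReal 0 1).real (Set.Ioi x) := by
    have := gaussianReal_map_neg (μ := 0) (v := 1)
    rw [neg_zero] at this
    conv_lhs => rw [← this]
    rw [map_measureReal_apply (by fun_prop) measurableSet_Iic]
    have h2 : (fun x : ℝ => -x) ⁻¹' Set.Iic (-x) = Set.Ici x := by ext; simp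
    rw [h2]
    have := nullSingletonClass_gaussianReal (μ := 0) (v := 1) one_ne_zero
    exact measureReal_congr Ioi_ae_eq_Ici.symm
  rw [stdNormalCDF, stdNormalCDF, cdf_eq_real, cdf_eq_real, h1, ← Set.compl_Iic,
    probReal_compl_eq_one_sub measurableSet_Iic]

lemma lowerTailRatio_eq [IsProbabilityMeasure P] (n : ℕ) (x : ℝ) :
    lowerTailRatio X P n x = upperTailRatio (fun i ω => -X i ω) P n x := by
  rw [lowerTailRatio, upperTailRatio, stdNormalCDF_neg]
  have h : ∀ ω, partialSum (fun i ω => -X i ω) n ω / selfNormalizer (fun i ω => -X i ω) n ω =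
      -(partialSum X n ω / selfNormalizer X n ω) := by
    intro ω
    simp [partialSum, selfNormalizer, neg_div]
  simp only [h, gt_iff_lt, lt_neg]

end Law

/-! ### Half-line Gaussian integrals and comparison with sums -/

/-- The half-line Gaussian integral `∫_0^∞ exp (-(α v + β v²)) dv`. -/
noncomputable def halfGauss (α β : ℝ) : ℝ :=
  ∫ v in Set.Ioi (0 : ℝ), Real.exp (-(α * v + β * v ^ 2))

lemma integrableOn_halfGauss {α β : ℝ} (hα : 0 ≤ α) (hβ : 0 < β) :
    IntegrableOn (fun v : ℝ => Real.exp (-(α * v + β * v ^ 2))) (Set.Ioi 0) := by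
  refine ((integrable_exp_neg_mul_sq hβ).integrableOn (s := Set.Ioi 0)).mono'
    (by fun_prop) ?_
  filter_upwards [ae_restrict_mem measurableSet_Ioi] with v hv
  rw [Real.norm_eq_abs, abs_of_pos (Real.exp_pos _), Real.exp_le_exp]
  have : 0 ≤ α * v := mul_nonneg hα (le_of_lt hv)
  linarith

lemma halfGauss_anti {α α' β β' : ℝ} (hα : 0 ≤ α) (hβ : 0 < β) (h : α ≤ α') (h' : β ≤ β') :
    halfGauss α' β' ≤ halfGauss α β := by
  refine setIntegral_mono_on (integrableOn_halfGauss (hα.trans h) (hβ.trans_le h'))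
    (integrableOn_halfGauss hα hβ) measurableSet_Ioi fun v hv => ?_
  have hv' : (0 : ℝ) ≤ v := le_of_lt hv
  rw [Real.exp_le_exp]
  gcongr

lemma halfGauss_scale (α β : ℝ) {c : ℝ} (hc : 0 < c) :
    halfGauss α β = c * halfGauss (c * α) (c ^ 2 * β) := by
  have := integral_comp_mul_left_Ioi' (fun v : ℝ => Real.exp (-(α * v + β * v ^ 2))) 0 hc
  rw [mul_zero, smul_eq_mul] at this
  rw [halfGauss, ← this, halfGauss]
  congr 1
  refine setIntegral_congr_fun measurableSet_Ioi fun v _ => ?_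
  ring_nf

lemma setIntegral_Ioi_add (f : ℝ → ℝ) (a : ℝ) :
    ∫ v in Set.Ioi a, f v = ∫ v in Set.Ioi 0, f (v + a) := by
  have := (measurePreserving_add_right volume a).setIntegral_preimage_emb
    (measurableEmbedding_addRight a) f (Set.Ioi a)
  rw [← this]
  simp

lemma halfGauss_tail_le {α β J : ℝ} (hα : 0 ≤ α) (hβ : 0 < β) (hJ : 0 ≤ J) :
    ∫ v in Set.Ioi J, Real.exp (-(α * v + β * v ^ 2)) ≤
      Real.exp (-(β * J ^ 2)) * halfGauss α β := by
  rw [setIntegral_Ioi_add, halfGauss, ← integral_const_mul]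
  have hi := integrableOn_halfGauss hα hβ
  have hle : ∀ v ∈ Set.Ioi (0 : ℝ), Real.exp (-(α * (v + J) + β * (v + J) ^ 2)) ≤
      Real.exp (-(β * J ^ 2)) * Real.exp (-(α * v + β * v ^ 2)) := by
    intro v hv
    have hv' : (0 : ℝ) < v := hv
    rw [← Real.exp_add, Real.exp_le_exp]
    have h1 : 0 ≤ α * J := by positivity
    have h2 : 0 ≤ β * (v * J) := by positivity
    nlinarith
  refine setIntegral_mono_on ?_ (hi.const_mul _) measurableSet_Ioi hle
  refine (hi.const_mul (Real.exp (-(β * J ^ 2)))).mono' (by fun_prop) ?_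
  filter_upwards [ae_restrict_mem measurableSet_Ioi] with v hv
  rw [Real.norm_eq_abs, abs_of_pos (Real.exp_pos _)]
  exact hle v hv

lemma halfGauss_intervalIntegral_ge {α β J : ℝ} (hα : 0 ≤ α) (hβ : 0 < β) (hJ : 0 ≤ J) :
    (1 - Real.exp (-(β * J ^ 2))) * halfGauss α β ≤
      ∫ v in (0 : ℝ)..J, Real.exp (-(α * v + β * v ^ 2)) := by
  have hi := integrableOn_halfGauss hα hβ
  have h := intervalIntegral.integral_interval_add_Ioi (a := 0) (b := J) hi
    (hi.mono_set (Set.Ioi_subset_Ioi hJ))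
  have h2 := halfGauss_tail_le hα hβ hJ
  have h3 : halfGauss α β = ∫ v in Set.Ioi (0 : ℝ), Real.exp (-(α * v + β * v ^ 2)) := rfl
  linarith

lemma intervalIntegral_le_halfGauss {α β J : ℝ} (hα : 0 ≤ α) (hβ : 0 < β) (hJ : 0 ≤ J) :
    ∫ v in (0 : ℝ)..J, Real.exp (-(α * v + β * v ^ 2)) ≤ halfGauss α β := by
  have hi := integrableOn_halfGauss hα hβ
  have h := intervalIntegral.integral_interval_add_Ioi (a := 0) (b := J) hi
    (hi.mono_set (Set.Ioi_subset_Ioi hJ))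
  have h2 : 0 ≤ ∫ v in Set.Ioi J, Real.exp (-(α * v + β * v ^ 2)) :=
    integral_nonneg fun v => (Real.exp_pos _).le
  have h3 : halfGauss α β = ∫ v in Set.Ioi (0 : ℝ), Real.exp (-(α * v + β * v ^ 2)) := rfl
  linarith

lemma antitoneOn_halfGauss_integrand {α β : ℝ} (hα : 0 ≤ α) (hβ : 0 ≤ β) :
    AntitoneOn (fun v : ℝ => Real.exp (-(α * v + β * v ^ 2))) (Set.Ici 0) := by
  intro v hv w hw hvw
  have hv' : (0 : ℝ) ≤ v := hv
  simp only [Real.exp_le_exp]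
  gcongr

/-- The summand decreases in `j`, so the terms with `j ≥ 1` lie below the integral; the `1` is the
term `j = 0`. -/
lemma sum_exp_le {α β : ℝ} (hα : 0 ≤ α) (hβ : 0 < β) (N : ℕ) :
    ∑ j ∈ Finset.range (N + 1), Real.exp (-(α * j + β * (j : ℝ) ^ 2)) ≤ 1 + halfGauss α β := by
  have h := AntitoneOn.sum_le_integral (x₀ := 0) (a := N)
    ((antitoneOn_halfGauss_integrand hα hβ.le).mono (fun v hv => hv.1))
  have h2 := intervalIntegral_le_halfGauss hα hβ (J := N) (by positivity)
  rw [Finset.sum_range_succ']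
  simp only [zero_add] at h
  simp only [Nat.cast_zero, mul_zero, ne_eq, OfNat.ofNat_ne_zero, not_false_eq_true, zero_pow,
    add_zero, neg_zero, Real.exp_zero]
  linarith

lemma sum_exp_ge {α β : ℝ} (hα : 0 ≤ α) (hβ : 0 < β) (N : ℕ) :
    (1 - Real.exp (-(β * (N : ℝ) ^ 2))) * halfGauss α β ≤
      ∑ j ∈ Finset.range N, Real.exp (-(α * j + β * (j : ℝ) ^ 2)) := by
  have h := AntitoneOn.integral_le_sum (x₀ := 0) (a := N)
    ((antitoneOn_halfGauss_integrand hα hβ.le).mono (fun v hv => hv.1))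
  have h2 := halfGauss_intervalIntegral_ge hα hβ (J := N) (by positivity)
  simp only [zero_add] at h
  linarith

/-! ### Mills ratio of the normal law -/

/-- The Mills ratio `(1 - Φ(x)) / φ(x)` of the standard normal law. -/
noncomputable def mills (x : ℝ) : ℝ := halfGauss x (1 / 2)

lemma one_sub_stdNormalCDF (x : ℝ) :
    1 - stdNormalCDF x = (√(2 * Real.pi))⁻¹ * Real.exp (-(x ^ 2 / 2)) * mills x := by
  rw [stdNormalCDF, cdf_eq_real, ← probReal_compl_eq_one_sub measurableSet_Iic, Set.compl_Iic,
    measureReal_def, gaussianReal_apply_eq_integral _ one_ne_zero, ENNReal.toReal_ofReal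
      (integral_nonneg fun v => gaussianPDFReal_nonneg _ _ _), setIntegral_Ioi_add, mills,
    halfGauss, ← integral_const_mul]
  refine setIntegral_congr_fun measurableSet_Ioi fun v _ => ?_
  simp only [gaussianPDFReal, NNReal.coe_one, mul_one, sub_zero]
  rw [mul_assoc, ← Real.exp_add]
  congr 2
  ring

lemma mills_anti {x y : ℝ} (hx : 0 ≤ x) (h : x ≤ y) : mills y ≤ mills x :=
  halfGauss_anti hx (by norm_num) h le_rfl

/-- On `[0, 1 / (x + 1)]` both `x v` and `v` are at most 1, so the integrand is at least `exp (-2)`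
there. -/
lemma mills_ge {x : ℝ} (hx : 0 ≤ x) : Real.exp (-2) / (x + 1) ≤ mills x := by
  have hx1 : 0 < x + 1 := by linarith
  have hJ : 0 ≤ 1 / (x + 1) := by positivity
  refine le_trans ?_ (intervalIntegral_le_halfGauss hx (by norm_num) hJ)
  have hc : ∫ _ in (0 : ℝ)..(1 / (x + 1)), Real.exp (-2) = Real.exp (-2) / (x + 1) := by
    simp [div_eq_mul_inv, mul_comm]
  rw [← hc]
  refine intervalIntegral.integral_mono_on hJ (by simp)
    (Continuous.intervalIntegrable (by fun_prop) _ _) fun v hv => ?_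
  rw [Real.exp_le_exp]
  have h1 : v * (x + 1) ≤ 1 := by
    have := hv.2
    rwa [le_div_iff₀ hx1] at this
  have h2 : 0 ≤ v := hv.1
  have h3 : v ≤ 1 := by nlinarith [mul_nonneg h2 hx]
  nlinarith [mul_nonneg h2 hx]

lemma mills_pos {x : ℝ} (hx : 0 ≤ x) : 0 < mills x :=
  lt_of_lt_of_le (by positivity) (mills_ge hx)

lemma integral_mul_exp_neg_half_sq :
    ∫ v in Set.Ioi (0 : ℝ), v * Real.exp (-(v ^ 2 / 2)) = 1 ∧
      IntegrableOn (fun v : ℝ => v * Real.exp (-(v ^ 2 / 2))) (Set.Ioi 0) := by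
  have hderiv : ∀ v ∈ Set.Ici (0 : ℝ), HasDerivAt (fun v : ℝ => -Real.exp (-(v ^ 2 / 2)))
      (v * Real.exp (-(v ^ 2 / 2))) v := by
    intro v _
    have h1 : HasDerivAt (fun v : ℝ => -(v ^ 2 / 2)) (-v) v := by
      have := ((hasDerivAt_pow 2 v).div_const 2).fun_neg
      refine this.congr_deriv ?_
      norm_num
    refine h1.exp.fun_neg.congr_deriv ?_
    ring
  have hlim : Tendsto (fun v : ℝ => -Real.exp (-(v ^ 2 / 2))) atTop (𝓝 0) := by
    rw [← neg_zero]
    refine (Real.tendsto_exp_neg_atTop_nhds_zero.comp ?_).neg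
    exact (tendsto_pow_atTop two_ne_zero).atTop_div_const (by norm_num)
  have hnn : ∀ v ∈ Set.Ioi (0 : ℝ), 0 ≤ v * Real.exp (-(v ^ 2 / 2)) := fun v hv =>
    mul_nonneg (le_of_lt hv) (Real.exp_pos _).le
  have := integral_Ioi_of_hasDerivAt_of_nonneg' hderiv hnn hlim
  exact ⟨by simpa using this, integrableOn_Ioi_deriv_of_nonneg' hderiv hnn hlim⟩

/-- Follows from `exp (-h v) ≥ 1 - h v`, the loss being at most `h ∫ v exp (-v² / 2) dv = h`. It
absorbs the rounding of `x √n` to the lattice. -/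
lemma mills_sub_le {x h : ℝ} (hx : 0 ≤ x) (hh : 0 ≤ h) : mills x - h ≤ mills (x + h) := by
  have hi := integrableOn_halfGauss hx (β := 1 / 2) (by norm_num)
  have hi' := integrableOn_halfGauss (add_nonneg hx hh) (β := 1 / 2) (by norm_num)
  obtain ⟨h1, h2⟩ := integral_mul_exp_neg_half_sq
  have key : mills x ≤ mills (x + h) +
      ∫ v in Set.Ioi (0 : ℝ), h * (v * Real.exp (-(v ^ 2 / 2))) := by
    rw [mills, mills, halfGauss, halfGauss, ← integral_add hi' (h2.const_mul h)]
    refine setIntegral_mono_on hi (hi'.add (h2.const_mul h)) measurableSet_Ioi fun v hv => ?_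
    have hv' : (0 : ℝ) < v := hv
    have e1 : Real.exp (-((x + h) * v + 1 / 2 * v ^ 2)) =
        Real.exp (-(x * v + 1 / 2 * v ^ 2)) * Real.exp (-(h * v)) := by
      rw [← Real.exp_add]; ring_nf
    have e2 : Real.exp (-(x * v + 1 / 2 * v ^ 2)) ≤ Real.exp (-(v ^ 2 / 2)) := by
      rw [Real.exp_le_exp]; nlinarith [mul_nonneg hx hv'.le]
    have e3 := Real.add_one_le_exp (-(h * v))
    have e4 := mul_nonneg hh hv'.le
    have e5 := Real.exp_pos (-(x * v + 1 / 2 * v ^ 2))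
    rw [e1]
    nlinarith [mul_le_mul_of_nonneg_left e2 e4, mul_le_mul_of_nonneg_left e3 e5.le]
  rw [integral_const_mul, h1] at key
  linarith

/-- Rescaling to standard deviation units: `D = n + 1` serves the upper bound on the tail, a
slightly smaller `D` the lower one. In both cases `D / (2n)` is close to `1 / 2`, the parameter of
`mills`. -/
lemma halfGauss_eq_mills_scale {k D n : ℝ} (hD : 0 < D) (hn : 0 < n) :
    halfGauss (2 * k / D) (2 / D) = D / (2 * √n) * halfGauss (k / √n) (D / (2 * n)) := by
  have hs : 0 < √n := Real.sqrt_pos.mpr hn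
  have hsq : √n ^ 2 = n := Real.sq_sqrt hn.le
  rw [halfGauss_scale _ _ (c := D / (2 * √n)) (by positivity)]
  congr 2
  · field_simp
  · rw [div_pow, mul_pow, hsq]
    field_simp

/-! ### Taylor bounds for the rate function -/

/-- The Cramér rate function of a Rademacher variable. -/
noncomputable def rateFun (t : ℝ) : ℝ :=
  ((1 + t) * Real.log (1 + t) + (1 - t) * Real.log (1 - t)) / 2

lemma nonneg_of_deriv_nonneg {f f' : ℝ → ℝ} {b t : ℝ} (h0 : f 0 = 0)
    (hc : ContinuousOn f (Set.Icc 0 b)) (hd : ∀ s ∈ Set.Ioo 0 b, HasDerivAt f (f' s) s)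
    (hf' : ∀ s ∈ Set.Ioo 0 b, 0 ≤ f' s) (ht : t ∈ Set.Icc 0 b) : 0 ≤ f t := by
  rw [← h0]
  refine monotoneOn_of_hasDerivWithinAt_nonneg (convex_Icc 0 b) hc (f' := f') ?_ ?_
    (Set.left_mem_Icc.mpr (ht.1.trans ht.2)) ht ht.1
  · intro s hs
    rw [interior_Icc] at hs
    exact (hd s hs).hasDerivWithinAt
  · intro s hs
    rw [interior_Icc] at hs
    exact hf' s hs

lemma hasDerivAt_log_one_add {t : ℝ} (h : -1 < t) :
    HasDerivAt (fun t => Real.log (1 + t)) (1 / (1 + t)) t :=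
  ((hasDerivAt_id t).const_add 1).log (by simp only [id]; linarith)

lemma hasDerivAt_log_one_sub {t : ℝ} (h : t < 1) :
    HasDerivAt (fun t => Real.log (1 - t)) (-1 / (1 - t)) t :=
  ((hasDerivAt_id t).const_sub 1).log (by simp only [id]; linarith)

lemma hasDerivAt_half_log_sub_log {t : ℝ} (h : -1 < t) (h' : t < 1) :
    HasDerivAt (fun t => (Real.log (1 + t) - Real.log (1 - t)) / 2) (1 / (1 - t ^ 2)) t := by
  refine (((hasDerivAt_log_one_add h).sub (hasDerivAt_log_one_sub h')).div_const 2).congr_deriv ?_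
  have h1 : 1 + t ≠ 0 := by linarith
  have h2 : 1 - t ≠ 0 := by linarith
  have h3 : 1 - t ^ 2 ≠ 0 := by
    rw [show 1 - t ^ 2 = (1 + t) * (1 - t) by ring]; exact mul_ne_zero h1 h2
  field_simp
  ring

lemma hasDerivAt_rateFun {t : ℝ} (h : -1 < t) (h' : t < 1) :
    HasDerivAt rateFun ((Real.log (1 + t) - Real.log (1 - t)) / 2) t := by
  have h1 : 1 + t ≠ 0 := by linarith
  have h2 : 1 - t ≠ 0 := by linarith
  refine ((((hasDerivAt_id t).const_add 1).mul (hasDerivAt_log_one_add h)).add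
    (((hasDerivAt_id t).const_sub 1).mul (hasDerivAt_log_one_sub h'))).div_const 2
    |>.congr_deriv ?_
  simp only [id]
  field_simp
  ring

/-- With `0 * log 0 = 0` there is no break at `t = ±1`. This lets `rateFun_ge` reach `t = 1`, the
case where all steps are `+1`. -/
lemma continuous_rateFun : Continuous rateFun := by
  have h := Real.continuous_mul_log
  have h1 : Continuous fun t : ℝ => (1 + t) * Real.log (1 + t) := h.comp (by fun_prop)
  have h2 : Continuous fun t : ℝ => (1 - t) * Real.log (1 - t) := h.comp (by fun_prop)
  exact (h1.add h2).div_const 2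

lemma add_cube_le_half_log {t : ℝ} (h0 : 0 ≤ t) (h1 : t < 1) :
    t + t ^ 3 / 3 ≤ (Real.log (1 + t) - Real.log (1 - t)) / 2 := by
  have hd : ∀ s, -1 < s → s < 1 → HasDerivAt
      (fun s => (Real.log (1 + s) - Real.log (1 - s)) / 2 - (s + s ^ 3 / 3))
      (1 / (1 - s ^ 2) - (1 + s ^ 2)) s := fun s hs hs' =>
    ((hasDerivAt_half_log_sub_log hs hs').sub
      ((hasDerivAt_id s).add ((hasDerivAt_pow 3 s).div_const 3))).congr_deriv (by norm_num)
  have := nonneg_of_deriv_nonneg (b := t) (t := t) (by simp)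
    (fun s hs => (hd s (by linarith [hs.1]) (by linarith [hs.2])).continuousAt.continuousWithinAt)
    (fun s hs => hd s (by linarith [hs.1]) (by linarith [hs.2])) (fun s hs => ?_) ⟨h0, le_rfl⟩
  · linarith
  · have hs2 : 0 < 1 - s ^ 2 := by nlinarith [hs.1, hs.2]
    rw [sub_nonneg, le_div_iff₀ hs2]
    nlinarith [sq_nonneg (s ^ 2)]

lemma half_log_le {t : ℝ} (h0 : 0 ≤ t) (h1 : t ≤ 1 / 2) :
    (Real.log (1 + t) - Real.log (1 - t)) / 2 ≤ t + t ^ 3 / 3 + t ^ 5 / 2 := by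
  have hd : ∀ s, -1 < s → s < 1 → HasDerivAt
      (fun s => (s + s ^ 3 / 3 + s ^ 5 / 2) - (Real.log (1 + s) - Real.log (1 - s)) / 2)
      ((1 + s ^ 2 + 5 / 2 * s ^ 4) - 1 / (1 - s ^ 2)) s := fun s hs hs' =>
    ((((hasDerivAt_id s).add ((hasDerivAt_pow 3 s).div_const 3)).add
      ((hasDerivAt_pow 5 s).div_const 2)).sub
      (hasDerivAt_half_log_sub_log hs hs')).congr_deriv (by norm_num; ring)
  have := nonneg_of_deriv_nonneg (b := t) (t := t) (by simp)
    (fun s hs => (hd s (by linarith [hs.1]) (by linarith [hs.2])).continuousAt.continuousWithinAt)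
    (fun s hs => hd s (by linarith [hs.1]) (by linarith [hs.2])) (fun s hs => ?_) ⟨h0, le_rfl⟩
  · linarith
  · have hs1 : s ^ 2 ≤ 1 / 4 := by nlinarith [hs.1, hs.2]
    have hs2 : 0 < 1 - s ^ 2 := by linarith
    rw [sub_nonneg, div_le_iff₀ hs2]
    nlinarith [mul_nonneg (sq_nonneg (s ^ 2)) (by linarith : 0 ≤ 1 / 4 - s ^ 2),
      sq_nonneg (s ^ 2)]

lemma rateFun_zero : rateFun 0 = 0 := by simp [rateFun]

lemma rateFun_ge {t : ℝ} (h0 : 0 ≤ t) (h1 : t ≤ 1) : t ^ 2 / 2 + t ^ 4 / 12 ≤ rateFun t := by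
  have := nonneg_of_deriv_nonneg (f := fun s => rateFun s - (s ^ 2 / 2 + s ^ 4 / 12))
    (f' := fun s => (Real.log (1 + s) - Real.log (1 - s)) / 2 - (s + s ^ 3 / 3))
    (b := 1) (t := t) (by simp [rateFun_zero])
    (continuous_rateFun.sub (by fun_prop)).continuousOn (fun s hs => ?_) (fun s hs => ?_) ⟨h0, h1⟩
  · linarith
  · refine ((hasDerivAt_rateFun (by linarith [hs.1]) hs.2).sub
      (((hasDerivAt_pow 2 s).div_const 2).add ((hasDerivAt_pow 4 s).div_const 12))).congr_deriv ?_
    norm_num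
    ring
  · exact sub_nonneg.mpr (add_cube_le_half_log hs.1.le hs.2)

lemma rateFun_le {t : ℝ} (h0 : 0 ≤ t) (h1 : t ≤ 1 / 2) :
    rateFun t ≤ t ^ 2 / 2 + t ^ 4 / 12 + t ^ 6 / 12 := by
  have := nonneg_of_deriv_nonneg
    (f := fun s => (s ^ 2 / 2 + s ^ 4 / 12 + s ^ 6 / 12) - rateFun s)
    (f' := fun s => (s + s ^ 3 / 3 + s ^ 5 / 2) - (Real.log (1 + s) - Real.log (1 - s)) / 2)
    (b := 1 / 2) (t := t) (by simp [rateFun_zero])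
    (Continuous.sub (by fun_prop) continuous_rateFun).continuousOn
    (fun s hs => ?_) (fun s hs => ?_) ⟨h0, h1⟩
  · linarith
  · refine (((((hasDerivAt_pow 2 s).div_const 2).add ((hasDerivAt_pow 4 s).div_const 12)).add
      ((hasDerivAt_pow 6 s).div_const 12)).sub
      (hasDerivAt_rateFun (by linarith [hs.1]) (by linarith [hs.2]))).congr_deriv ?_
    norm_num
    ring
  · exact sub_nonneg.mpr (half_log_le hs.1.le hs.2.le)

/-! ### Binomial coefficients: entropy bound, Stirling, successive ratios -/

lemma one_sub_le_mul_exp {s : ℝ} (h0 : 0 ≤ s) (h1 : s < 1) :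
    1 - s ≤ (1 + s) * Real.exp (-(2 * s)) := by
  have h := add_cube_le_half_log h0 h1
  have h3 : 0 ≤ s ^ 3 := by positivity
  have h4 : Real.log (1 - s) ≤ Real.log ((1 + s) * Real.exp (-(2 * s))) := by
    rw [Real.log_mul (by linarith) (Real.exp_ne_zero _), Real.log_exp]
    linarith
  exact (Real.log_le_log_iff (by linarith) (by positivity)).mp h4

lemma mul_exp_le_one_sub {s : ℝ} (h1 : s < 1) :
    (1 + s) * Real.exp (-(2 * s / (1 - s))) ≤ 1 - s := by
  have h2 : 0 < 1 - s := by linarith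
  have h := Real.add_one_le_exp (2 * s / (1 - s))
  have h3 : 2 * s / (1 - s) + 1 = (1 + s) / (1 - s) := by field_simp; ring
  rw [Real.exp_neg, ← div_eq_mul_inv, div_le_iff₀ (Real.exp_pos _)]
  rw [h3, div_le_iff₀ h2] at h
  linarith

lemma exp_neg_mul_rateFun (a b : ℕ) (h : 0 < a + b) :
    Real.exp (-(((a + b : ℕ) : ℝ) * rateFun (((a : ℝ) - b) / (a + b : ℕ)))) =
      ((2 * (a : ℝ) / (a + b : ℕ)) ^ a * (2 * (b : ℝ) / (a + b : ℕ)) ^ b)⁻¹ := by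
  have hn : (0 : ℝ) < ((a + b : ℕ) : ℝ) := by exact_mod_cast h
  set n : ℝ := ((a + b : ℕ) : ℝ) with hnd
  have hab : n = a + b := by rw [hnd]; push_cast; ring
  have h1 : 1 + ((a : ℝ) - b) / n = 2 * a / n := by field_simp; rw [hab]; ring
  have h2 : 1 - ((a : ℝ) - b) / n = 2 * b / n := by field_simp; rw [hab]; ring
  have hp : ∀ m : ℕ, (2 * (m : ℝ) / n) ^ m = Real.exp (m * Real.log (2 * m / n)) := by
    intro m
    rcases Nat.eq_zero_or_pos m with h | h
    · simp [h]
    · have : (0 : ℝ) < m := by exact_mod_cast h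
      rw [Real.exp_nat_mul, Real.exp_log (by positivity)]
  rw [hp, hp, ← Real.exp_add, ← Real.exp_neg, rateFun, h1, h2]
  congr 1
  field_simp

/-- A single term of the expansion of `(a / n + b / n) ^ n = 1` is at most 1. -/
lemma choose_div_le (a b : ℕ) (h : 0 < a + b) :
    ((a + b).choose a : ℝ) / 2 ^ (a + b) ≤
      Real.exp (-(((a + b : ℕ) : ℝ) * rateFun (((a : ℝ) - b) / (a + b : ℕ)))) := by
  have hn : (0 : ℝ) < ((a + b : ℕ) : ℝ) := by exact_mod_cast h
  rw [exp_neg_mul_rateFun a b h]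
  set n : ℝ := ((a + b : ℕ) : ℝ) with hnd
  have hab : n = a + b := by rw [hnd]; push_cast; ring
  have hpos : ∀ m : ℕ, (0 : ℝ) < (2 * (m : ℝ) / n) ^ m := by
    intro m
    rcases Nat.eq_zero_or_pos m with h | h
    · simp [h]
    · have : (0 : ℝ) < m := by exact_mod_cast h
      positivity
  have key : ((a : ℝ) / n) ^ a * (b / n) ^ b * ((a + b).choose a : ℝ) ≤ 1 := by
    have h1 := add_pow ((a : ℝ) / n) (b / n) (a + b)
    rw [← add_div, ← hab, div_self hn.ne', one_pow] at h1
    rw [h1]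
    have := Finset.single_le_sum (s := Finset.range (a + b + 1)) (f := fun m =>
      ((a : ℝ) / n) ^ m * (b / n) ^ (a + b - m) * ((a + b).choose m : ℝ))
      (fun m _ => by positivity) (a := a) (by simp)
    simpa using this
  rw [div_le_iff₀ (by positivity), inv_mul_eq_div, le_div_iff₀ (mul_pos (hpos a) (hpos b))]
  have e : (2 * (a : ℝ) / n) ^ a * (2 * (b : ℝ) / n) ^ b =
      2 ^ (a + b) * (((a : ℝ) / n) ^ a * (b / n) ^ b) := by
    rw [mul_div_assoc, mul_div_assoc, mul_pow, mul_pow, pow_add]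
    ring
  rw [e]
  nlinarith [pow_pos (two_pos : (0 : ℝ) < 2) (a + b)]

lemma factorial_eq_stirlingSeq {n : ℕ} (hn : 0 < n) :
    (n.factorial : ℝ) = Stirling.stirlingSeq n * (√(2 * n) * (n / Real.exp 1) ^ n) := by
  have h : (0 : ℝ) < n := by exact_mod_cast hn
  rw [Stirling.stirlingSeq, div_mul_cancel₀]
  positivity

lemma stirlingSeq_pos {n : ℕ} (hn : 0 < n) : 0 < Stirling.stirlingSeq n := by
  have h : (0 : ℝ) < n := by exact_mod_cast hn
  rw [Stirling.stirlingSeq]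
  positivity

lemma choose_div_eq {a b : ℕ} (ha : 0 < a) (hb : 0 < b) :
    ((a + b).choose a : ℝ) / 2 ^ (a + b) =
      Stirling.stirlingSeq (a + b) / (Stirling.stirlingSeq a * Stirling.stirlingSeq b) *
        √((a + b : ℕ) / (2 * a * b)) *
        Real.exp (-(((a + b : ℕ) : ℝ) * rateFun (((a : ℝ) - b) / (a + b : ℕ)))) := by
  have ha' : (0 : ℝ) < a := by exact_mod_cast ha
  have hb' : (0 : ℝ) < b := by exact_mod_cast hb
  have hn : (0 : ℝ) < ((a + b : ℕ) : ℝ) := by exact_mod_cast (by omega : 0 < a + b)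
  rw [exp_neg_mul_rateFun a b (by omega), Nat.cast_add_choose, factorial_eq_stirlingSeq ha,
    factorial_eq_stirlingSeq hb, factorial_eq_stirlingSeq (by omega : 0 < a + b)]
  have hsa := stirlingSeq_pos ha
  have hsb := stirlingSeq_pos hb
  set n : ℝ := ((a + b : ℕ) : ℝ) with hnd
  have hs : √(n / (2 * a * b)) = √(2 * n) / (√(2 * a) * √(2 * b)) := by
    rw [← Real.sqrt_mul (by positivity), ← Real.sqrt_div (by positivity)]
    congr 1
    field_simp
  rw [hs]
  simp only [div_pow, mul_pow, pow_add]
  field_simp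

lemma choose_step (n a : ℕ) {s : ℝ} (ha : a < n) (hs : s = (2 * (a : ℝ) - n + 1) / (n + 1)) :
    (n.choose (a + 1) : ℝ) * (1 + s) = n.choose a * (1 - s) := by
  have h : ((n.choose (a + 1) : ℝ)) * (a + 1) = n.choose a * (n - a) := by
    have := Nat.choose_succ_right_eq n a
    rw [← Nat.cast_sub ha.le]
    exact_mod_cast this
  have h1 : 1 + s = 2 / (n + 1) * (a + 1) := by rw [hs]; field_simp; ring
  have h2 : 1 - s = 2 / (n + 1) * (n - a) := by rw [hs]; field_simp; ring
  rw [h1, h2]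
  linear_combination 2 / ((n : ℝ) + 1) * h

/-- Each step multiplies the coefficient by `(1 - s) / (1 + s) ≤ exp (-2s)` with `s = (k + 2i + 1) /
(n + 1)`, and the odd numbers `2i + 1` for `i < j` sum to `j²`. -/
lemma choose_le_mul_exp (n a : ℕ) {k : ℝ} (hk : k = 2 * (a : ℝ) - n) (hk0 : 0 ≤ k) (j : ℕ) :
    (n.choose (a + j) : ℝ) ≤
      n.choose a * Real.exp (-(2 * k / (n + 1) * j + 2 / (n + 1) * (j : ℝ) ^ 2)) := by
  induction j with
  | zero => simp
  | succ j ih =>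
    rcases Nat.lt_or_ge (a + j) n with h | h
    · have hst := choose_step n (a + j) h rfl
      set s : ℝ := (2 * ((a + j : ℕ) : ℝ) - n + 1) / (n + 1) with hs
      have hs' : s = (k + 2 * j + 1) / (n + 1) := by rw [hs, hk]; push_cast; ring
      have hs0 : 0 ≤ s := by rw [hs']; positivity
      have hs1 : s < 1 := by
        have : ((a + j : ℕ) : ℝ) + 1 ≤ n := by exact_mod_cast h
        rw [hs, div_lt_one (by positivity)]
        linarith
      have hb := one_sub_le_mul_exp hs0 hs1
      have e : Real.exp (-(2 * k / (n + 1) * (j + 1 : ℕ) + 2 / (n + 1) * ((j + 1 : ℕ) : ℝ) ^ 2)) =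
          Real.exp (-(2 * k / (n + 1) * j + 2 / (n + 1) * (j : ℝ) ^ 2)) *
            Real.exp (-(2 * s)) := by
        rw [← Real.exp_add, hs']
        congr 1
        push_cast
        field_simp
        ring
      rw [e, ← mul_assoc]
      have h1 : (n.choose (a + j + 1) : ℝ) * (1 + s) ≤
          n.choose (a + j) * Real.exp (-(2 * s)) * (1 + s) := by
        rw [hst]
        nlinarith [mul_le_mul_of_nonneg_left hb (Nat.cast_nonneg (α := ℝ) (n.choose (a + j)))]
      refine (le_of_mul_le_mul_right h1 (by linarith)).trans ?_
      gcongr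
    · rw [Nat.choose_eq_zero_of_lt (by omega)]
      simp only [Nat.cast_zero]
      positivity

/-- The reverse bound is `(1 - s) / (1 + s) ≥ exp (-2s / (1 - s))`. Within the first `N` steps `1 -
s ≥ D / (n + 1)`, so the same exponent appears with `D` in place of `n + 1`. -/
lemma mul_exp_le_choose (n a N : ℕ) {k D : ℝ} (hk : k = 2 * (a : ℝ) - n) (hk0 : 0 ≤ k)
    (hD : D = n + 1 - (k + 2 * N)) (hD0 : 0 < D) (j : ℕ) (hj : j ≤ N) :
    n.choose a * Real.exp (-(2 * k / D * j + 2 / D * (j : ℝ) ^ 2)) ≤ n.choose (a + j) := by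
  induction j with
  | zero => simp
  | succ j ih =>
    have hjN : (j : ℝ) + 1 ≤ N := by exact_mod_cast hj
    have h : a + j < n := by
      have : ((a + j : ℕ) : ℝ) < n := by push_cast; linarith
      exact_mod_cast this
    have hst := choose_step n (a + j) h rfl
    set s : ℝ := (2 * ((a + j : ℕ) : ℝ) - n + 1) / (n + 1) with hs
    have hs' : s = (k + 2 * j + 1) / (n + 1) := by rw [hs, hk]; push_cast; ring
    have hs0 : 0 ≤ s := by rw [hs']; positivity
    have hDs : D / (n + 1) ≤ 1 - s := by
      rw [hs', hD, le_sub_iff_add_le, ← add_div, div_le_one (by positivity)]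
      linarith
    have hs1 : s < 1 := by
      have : 0 < D / ((n : ℝ) + 1) := by positivity
      linarith
    have hb := mul_exp_le_one_sub hs1
    have hle : 2 * s / (1 - s) ≤ 2 * (k + 2 * j + 1) / D := by
      refine (div_le_div_of_nonneg_left (by positivity) (by positivity) hDs).trans_eq ?_
      rw [hs']
      field_simp
    have e : Real.exp (-(2 * k / D * (j + 1 : ℕ) + 2 / D * ((j + 1 : ℕ) : ℝ) ^ 2)) =
        Real.exp (-(2 * k / D * j + 2 / D * (j : ℝ) ^ 2)) *
          Real.exp (-(2 * (k + 2 * j + 1) / D)) := by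
      rw [← Real.exp_add]
      congr 1
      push_cast
      field_simp
      ring
    rw [e, ← mul_assoc]
    have h0 : Real.exp (-(2 * (k + 2 * j + 1) / D)) ≤ Real.exp (-(2 * s / (1 - s))) := by
      rw [Real.exp_le_exp]; linarith
    refine (mul_le_mul (ih (by omega)) h0 (Real.exp_pos _).le (by positivity)).trans ?_
    refine le_of_mul_le_mul_right ?_ (by linarith : 0 < 1 + s)
    rw [← add_assoc, hst]
    nlinarith [mul_le_mul_of_nonneg_left hb (Nat.cast_nonneg (α := ℝ) (n.choose (a + j)))]

/-! ### Two-sided bounds for the binomial tail -/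

/-- The first index in the sum defining `binomTail n y`. -/
noncomputable def tailStart (n : ℕ) (y : ℝ) : ℕ := ⌊(n + y) / 2⌋₊ + 1

lemma tailStart_le_iff {n a : ℕ} {y : ℝ} (hy : 0 ≤ y) :
    tailStart n y ≤ a ↔ y < 2 * (a : ℝ) - n := by
  rw [tailStart, Nat.succ_le_iff, Nat.floor_lt (by positivity)]
  constructor <;> intro h <;> linarith

lemma lt_two_mul_tailStart {n : ℕ} {y : ℝ} (hy : 0 ≤ y) : y < 2 * (tailStart n y : ℝ) - n :=
  (tailStart_le_iff hy).mp le_rfl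

lemma two_mul_tailStart_le {n : ℕ} {y : ℝ} (hy : 0 ≤ y) :
    2 * (tailStart n y : ℝ) - n ≤ y + 2 := by
  have := Nat.floor_le (by positivity : 0 ≤ ((n : ℝ) + y) / 2)
  rw [tailStart]
  push_cast
  linarith

lemma binomTail_eq {n : ℕ} {y : ℝ} (hy : 0 ≤ y) :
    binomTail n y = ∑ j ∈ Finset.range (n + 1 - tailStart n y),
      (n.choose (tailStart n y + j) : ℝ) / 2 ^ n := by
  rw [← Finset.sum_Ico_eq_sum_range (fun a => (n.choose a : ℝ) / 2 ^ n), binomTail,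
    ← Finset.sum_filter]
  refine Finset.sum_congr ?_ fun _ _ => rfl
  ext a
  simp only [Finset.mem_filter, Finset.mem_range, Finset.mem_Ico, tailStart_le_iff hy, and_comm]

lemma binomTail_le {n : ℕ} (hn : 0 < n) {x k : ℝ} (hx : 0 ≤ x)
    (hk : k = 2 * (tailStart n (x * √n) : ℝ) - n) :
    binomTail n (x * √n) ≤ (n.choose (tailStart n (x * √n)) : ℝ) / 2 ^ n *
      (1 + (n + 1) / (2 * √n) * mills x) := by
  have hn' : (0 : ℝ) < n := by exact_mod_cast hn
  have hsn : 0 < √(n : ℝ) := Real.sqrt_pos.mpr hn'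
  have hy : 0 ≤ x * √n := by positivity
  have hky : x * √n < k := hk ▸ lt_two_mul_tailStart hy
  have hk0 : 0 ≤ k := hy.trans hky.le
  rw [binomTail_eq hy]
  set a := tailStart n (x * √n)
  have h1 : ∑ j ∈ Finset.range (n + 1 - a), (n.choose (a + j) : ℝ) / 2 ^ n ≤
      (n.choose a : ℝ) / 2 ^ n * ∑ j ∈ Finset.range (n + 1 - a),
        Real.exp (-(2 * k / (n + 1) * j + 2 / (n + 1) * (j : ℝ) ^ 2)) := by
    rw [Finset.mul_sum]
    refine Finset.sum_le_sum fun j _ => ?_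
    rw [div_mul_eq_mul_div]
    gcongr
    exact choose_le_mul_exp n a hk hk0 j
  refine h1.trans (mul_le_mul_of_nonneg_left ?_ (by positivity))
  have h2 : ∑ j ∈ Finset.range (n + 1 - a),
      Real.exp (-(2 * k / (n + 1) * j + 2 / (n + 1) * (j : ℝ) ^ 2)) ≤
      1 + halfGauss (2 * k / (n + 1)) (2 / (n + 1)) := by
    refine le_trans ?_ (sum_exp_le (by positivity) (by positivity) n)
    exact Finset.sum_le_sum_of_subset_of_nonneg (Finset.range_mono (by omega))
      fun _ _ _ => (Real.exp_pos _).le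
  refine h2.trans ?_
  rw [halfGauss_eq_mills_scale (by positivity) hn']
  gcongr
  refine halfGauss_anti hx (by norm_num) ?_ ?_
  · rw [le_div_iff₀ hsn]; exact hky.le
  · rw [div_le_div_iff₀ (by norm_num) (by positivity)]; linarith

lemma le_binomTail {n N : ℕ} (hn : 0 < n) (hN : 0 < N) {x k D : ℝ} (hx : 0 ≤ x)
    (hk : k = 2 * (tailStart n (x * √n) : ℝ) - n) (hD : D = n + 1 - (k + 2 * N)) (hD0 : 0 < D) :
    (n.choose (tailStart n (x * √n)) : ℝ) / 2 ^ n *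
      ((1 - Real.exp (-(2 / n * (N : ℝ) ^ 2))) * (D / (2 * √n) * mills (k / √n))) ≤
      binomTail n (x * √n) := by
  have hn' : (0 : ℝ) < n := by exact_mod_cast hn
  have hN' : (1 : ℝ) ≤ N := by exact_mod_cast hN
  have hsn : 0 < √(n : ℝ) := Real.sqrt_pos.mpr hn'
  have hy : 0 ≤ x * √n := by positivity
  have hky : x * √n < k := hk ▸ lt_two_mul_tailStart hy
  have hk0 : 0 ≤ k := hy.trans hky.le
  have hDn : D ≤ n := by linarith
  rw [binomTail_eq hy]
  set a := tailStart n (x * √n)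
  -- Positivity of `D` keeps the window of `N` terms inside the range of the tail sum.
  have haN : a + N ≤ n := by
    have : ((a + N : ℕ) : ℝ) < n + 1 := by push_cast; linarith
    exact Nat.lt_succ_iff.mp (by exact_mod_cast this)
  have h1 : (n.choose a : ℝ) / 2 ^ n * ∑ j ∈ Finset.range N,
        Real.exp (-(2 * k / D * j + 2 / D * (j : ℝ) ^ 2)) ≤
      ∑ j ∈ Finset.range (n + 1 - a), (n.choose (a + j) : ℝ) / 2 ^ n := by
    rw [Finset.mul_sum]
    refine (Finset.sum_le_sum fun j hj => ?_).trans (Finset.sum_le_sum_of_subset_of_nonneg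
      (Finset.range_mono (by omega : N ≤ n + 1 - a)) fun _ _ _ => by positivity)
    rw [div_mul_eq_mul_div]
    gcongr
    exact mul_exp_le_choose n a N hk hk0 hD hD0 j (Finset.mem_range.mp hj).le
  refine le_trans (mul_le_mul_of_nonneg_left ?_ (by positivity)) h1
  refine le_trans ?_ (sum_exp_ge (by positivity) (by positivity) N)
  rw [halfGauss_eq_mills_scale hD0 hn']
  have h3 : mills (k / √n) ≤ halfGauss (k / √n) (D / (2 * n)) := by
    refine halfGauss_anti (by positivity) (by positivity) le_rfl ?_
    rw [div_le_div_iff₀ (by positivity) (by norm_num)]; linarith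
  have h4 : Real.exp (-(2 / D * (N : ℝ) ^ 2)) ≤ Real.exp (-(2 / n * (N : ℝ) ^ 2)) := by
    rw [Real.exp_le_exp, neg_le_neg_iff]
    gcongr
  have h5 : Real.exp (-(2 / n * (N : ℝ) ^ 2)) ≤ 1 := by
    rw [Real.exp_le_one_iff, neg_nonpos]; positivity
  have h6 := mills_pos (x := k / √n) (by positivity)
  exact mul_le_mul (by linarith) (mul_le_mul_of_nonneg_left h3 (by positivity))
    (by positivity) (by linarith)

/-! ### Rough bound outside the range `x = o(√n)` -/

/-- The ratio of the upper tails of a normalized symmetric binomial and a standard normal. -/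
noncomputable def binomRatio (n : ℕ) (x : ℝ) : ℝ := binomTail n (x * √n) / (1 - stdNormalCDF x)

/-- Each of the at most `n + 1` terms obeys the entropy bound, whose exponent is controlled by
`rateFun_ge`. The quartic term is what beats the Gaussian tail. -/
lemma binomTail_rough_le {n : ℕ} (hn : 0 < n) {x : ℝ} (hx : 0 ≤ x) :
    binomTail n (x * √n) ≤ (n + 1) * Real.exp (-(x ^ 2 / 2 + x ^ 4 / (12 * n))) := by
  have hn' : (0 : ℝ) < n := by exact_mod_cast hn
  have hsn : 0 < √(n : ℝ) := Real.sqrt_pos.mpr hn'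
  have hsq : √(n : ℝ) ^ 2 = n := Real.sq_sqrt hn'.le
  have key : ∀ a ∈ Finset.range (n + 1),
      (if x * √n < 2 * (a : ℝ) - n then (n.choose a : ℝ) / 2 ^ n else 0) ≤
        Real.exp (-(x ^ 2 / 2 + x ^ 4 / (12 * n))) := by
    intro a ha
    split_ifs with h
    · obtain ⟨b, rfl⟩ := Nat.exists_eq_add_of_le (Nat.lt_succ_iff.mp (Finset.mem_range.mp ha))
      refine (choose_div_le a b hn).trans ?_
      rw [Real.exp_le_exp, neg_le_neg_iff]
      set n : ℝ := ((a + b : ℕ) : ℝ) with hnd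
      have hab : n = a + b := by rw [hnd]; push_cast; ring
      set u : ℝ := ((a : ℝ) - b) / n with hu
      have hnu : n * u = a - b := by rw [hu]; field_simp
      have hxu : x ≤ u * √n := by
        refine le_of_mul_le_mul_right ?_ hsn
        have : u * √n * √n = n * u := by rw [mul_assoc, ← sq, hsq]; ring
        rw [this, hnu]
        linarith
      have hu0 : 0 ≤ u := by
        by_contra hneg
        push Not at hneg
        linarith [mul_neg_of_neg_of_pos hneg hsn]
      have hu1 : u ≤ 1 := by
        rw [hu, div_le_one hn', hab]
        linarith [(Nat.cast_nonneg b : (0 : ℝ) ≤ b)]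
      have h1 : x ^ 2 ≤ n * u ^ 2 := by
        calc x ^ 2 ≤ (u * √n) ^ 2 := by gcongr
          _ = n * u ^ 2 := by rw [mul_pow, hsq]; ring
      have h2 : x ^ 4 / n ≤ n * u ^ 4 := by
        rw [div_le_iff₀ hn']
        calc x ^ 4 = (x ^ 2) ^ 2 := by ring
          _ ≤ (n * u ^ 2) ^ 2 := by gcongr
          _ = n * u ^ 4 * n := by ring
      have h3 := mul_le_mul_of_nonneg_left (rateFun_ge hu0 hu1) hn'.le
      have h4 : x ^ 4 / (12 * n) = x ^ 4 / n / 12 := by field_simp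
      rw [h4]
      linarith
    · positivity
  have := Finset.sum_le_card_nsmul _ _ _ key
  simpa [binomTail] using this

lemma binomTail_eq_zero {n : ℕ} {y : ℝ} (hy : (n : ℝ) ≤ y) : binomTail n y = 0 := by
  refine Finset.sum_eq_zero fun a ha => if_neg ?_
  have : (a : ℝ) ≤ n := by exact_mod_cast Nat.lt_succ_iff.mp (Finset.mem_range.mp ha)
  linarith

lemma inv_one_sub_stdNormalCDF_le {x : ℝ} (hx : 0 ≤ x) :
    (1 - stdNormalCDF x)⁻¹ ≤ √(2 * Real.pi) * Real.exp 2 * (x + 1) * Real.exp (x ^ 2 / 2) := by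
  have h : Real.exp (-2) / (x + 1) ≤ mills x := mills_ge hx
  have hpi : 0 < √(2 * Real.pi) := by positivity
  rw [one_sub_stdNormalCDF]
  have hx1 : 0 < x + 1 := by linarith
  refine (inv_anti₀ (by positivity) (mul_le_mul_of_nonneg_left h (by positivity))).trans_eq ?_
  rw [Real.exp_neg, Real.exp_neg]
  field_simp

lemma one_sub_stdNormalCDF_pos {x : ℝ} (hx : 0 ≤ x) : 0 < 1 - stdNormalCDF x := by
  have := mills_pos hx
  rw [one_sub_stdNormalCDF]
  positivity

lemma binomRatio_le {n : ℕ} (hn : 0 < n) {x η : ℝ} (hη : 0 < η) (hx : η * √n ≤ x) :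
    binomRatio n x ≤ √(2 * Real.pi) * Real.exp 2 * 4 *
      ((n : ℝ) ^ 2 * Real.exp (-(η ^ 4 / 12)) ^ n) := by
  have hn' : (1 : ℝ) ≤ n := by exact_mod_cast hn
  have hsn : 0 < √(n : ℝ) := Real.sqrt_pos.mpr (by linarith)
  have hsq : √(n : ℝ) ^ 2 = n := Real.sq_sqrt (by linarith)
  have hx0 : 0 ≤ x := le_trans (by positivity) hx
  -- For `x ≥ √n` the tail is empty; otherwise `x + 1 ≤ 2n`, so the prefactors are at most of order
  -- `n²`.
  rcases le_or_gt (√(n : ℝ)) x with h | h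
  · have : (n : ℝ) ≤ x * √n := by nlinarith
    rw [binomRatio, binomTail_eq_zero this, zero_div]
    positivity
  · have h1 : x + 1 ≤ 2 * n := by
      have : √(n : ℝ) ≤ n := (Real.sqrt_le_left (by linarith)).mpr (by nlinarith)
      linarith
    have h2 : η ^ 4 / 12 * n ≤ x ^ 4 / (12 * n) := by
      rw [le_div_iff₀ (by positivity)]
      calc η ^ 4 / 12 * n * (12 * n) = (η * √n) ^ 4 := by
            rw [mul_pow, show √(n : ℝ) ^ 4 = (√(n : ℝ) ^ 2) ^ 2 by ring, hsq]; ring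
        _ ≤ x ^ 4 := by gcongr
    rw [binomRatio, div_eq_mul_inv]
    calc binomTail n (x * √n) * (1 - stdNormalCDF x)⁻¹
        ≤ ((n + 1) * Real.exp (-(x ^ 2 / 2 + x ^ 4 / (12 * n)))) *
          (√(2 * Real.pi) * Real.exp 2 * (x + 1) * Real.exp (x ^ 2 / 2)) :=
          mul_le_mul (binomTail_rough_le hn hx0) (inv_one_sub_stdNormalCDF_le hx0)
            (inv_nonneg.mpr (one_sub_stdNormalCDF_pos hx0).le) (by positivity)
      _ = √(2 * Real.pi) * Real.exp 2 * ((n + 1) * (x + 1)) * Real.exp (-(x ^ 4 / (12 * n))) := by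
          rw [neg_add, Real.exp_add, Real.exp_neg (x ^ 2 / 2)]
          field_simp
      _ ≤ √(2 * Real.pi) * Real.exp 2 * ((2 * n) * (2 * n)) * Real.exp (-(η ^ 4 / 12 * n)) := by
          gcongr
          linarith
      _ = _ := by
          rw [← Real.exp_nat_mul]
          ring_nf

/-- If `x n ≥ η √n` infinitely often, `binomRatio_le` makes the ratio exponentially small along
those `n`, so it cannot tend to 1. -/
lemma tendsto_div_sqrt_of_binomRatio {x : ℕ → ℝ} (hx : ∀ n, 0 ≤ x n)
    (h : Tendsto (fun n => binomRatio n (x n)) atTop (𝓝 1)) :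
    Tendsto (fun n => x n / √n) atTop (𝓝 0) := by
  rw [Metric.tendsto_atTop']
  have key : ∀ η > 0, ∀ᶠ n : ℕ in atTop, x n / √n < η := by
    intro η hη
    have h1 := (tendsto_pow_const_mul_const_pow_of_abs_lt_one 2
      (r := Real.exp (-(η ^ 4 / 12))) (by
        rw [abs_of_pos (Real.exp_pos _), Real.exp_lt_one_iff]
        have : 0 < η ^ 4 := by positivity
        linarith)).const_mul (√(2 * Real.pi) * Real.exp 2 * 4)
    rw [mul_zero] at h1
    filter_upwards [h1.eventually_lt h zero_lt_one, eventually_gt_atTop 0] with n hn hn0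
    by_contra hcon
    have hsn : 0 < √(n : ℝ) := Real.sqrt_pos.mpr (by exact_mod_cast hn0)
    rw [not_lt, le_div_iff₀ hsn] at hcon
    exact absurd (binomRatio_le hn0 hη hcon) (not_le.mpr hn)
  intro η hη
  obtain ⟨M, hM⟩ := eventually_atTop.mp (key η hη)
  refine ⟨M, fun n hn => ?_⟩
  rw [Real.dist_eq, sub_zero, abs_of_nonneg (div_nonneg (hx n) (Real.sqrt_nonneg _))]
  exact hM n hn.le

/-! ### Asymptotics for `x = o(√n)` -/

section Asymptotics

variable {x : ℕ → ℝ}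

/-- The offset `2 a - n` of the first index `a` in the tail sum at level `x √n`. -/
noncomputable def tailOffset (x : ℕ → ℝ) (n : ℕ) : ℝ := 2 * (tailStart n (x n * √n) : ℝ) - n

lemma lt_tailOffset (hx : ∀ n, 0 ≤ x n) (n : ℕ) : x n * √n < tailOffset x n :=
  lt_two_mul_tailStart (mul_nonneg (hx n) (Real.sqrt_nonneg _))

lemma tailOffset_le (hx : ∀ n, 0 ≤ x n) (n : ℕ) : tailOffset x n ≤ x n * √n + 2 :=
  two_mul_tailStart_le (mul_nonneg (hx n) (Real.sqrt_nonneg _))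

lemma tailOffset_pos (hx : ∀ n, 0 ≤ x n) (n : ℕ) : 0 < tailOffset x n :=
  (mul_nonneg (hx n) (Real.sqrt_nonneg _)).trans_lt (lt_tailOffset hx n)

lemma div_sqrt_le_tailOffset_div (hx : ∀ n, 0 ≤ x n) {n : ℕ} (hn : 0 < n) :
    x n / √n ≤ tailOffset x n / n ∧ tailOffset x n / n ≤ x n / √n + 2 / n := by
  have hn' : (0 : ℝ) < n := by exact_mod_cast hn
  have e : x n / √n = x n * √n / n := by
    have : 0 < √(n : ℝ) := Real.sqrt_pos.mpr hn'
    rw [div_eq_div_iff this.ne' hn'.ne', mul_assoc, Real.mul_self_sqrt hn'.le]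
  rw [e, ← add_div]
  exact ⟨by gcongr; exact (lt_tailOffset hx n).le, by gcongr; exact tailOffset_le hx n⟩

lemma tendsto_tailOffset_div (hx : ∀ n, 0 ≤ x n)
    (h : Tendsto (fun n => x n / √n) atTop (𝓝 0)) :
    Tendsto (fun n => tailOffset x n / n) atTop (𝓝 0) := by
  have h2 : Tendsto (fun n : ℕ => x n / √n + 2 / n) atTop (𝓝 0) := by
    simpa using h.add (tendsto_const_div_atTop_nhds_zero_nat 2)
  refine tendsto_of_tendsto_of_tendsto_of_le_of_le' tendsto_const_nhds h2 ?_ ?_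
  · exact Eventually.of_forall fun n => div_nonneg (tailOffset_pos hx n).le (Nat.cast_nonneg _)
  · filter_upwards [eventually_gt_atTop 0] with n hn using (div_sqrt_le_tailOffset_div hx hn).2

/-- The binomial weight of the first index in the tail sum at level `x √n`. -/
noncomputable def headWeight (x : ℕ → ℝ) (n : ℕ) : ℝ :=
  (n.choose (tailStart n (x n * √n)) : ℝ) / 2 ^ n

lemma tendsto_headWeight (hx : ∀ n, 0 ≤ x n) (h : Tendsto (fun n => x n / √n) atTop (𝓝 0)) :
    Tendsto (fun n : ℕ => headWeight x n * √n * Real.exp (n * rateFun (tailOffset x n / n)))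
      atTop (𝓝 (√2 / √Real.pi)) := by
  have hu := tendsto_tailOffset_div hx h
  set u : ℕ → ℝ := fun n => tailOffset x n / n with hu_def
  set a : ℕ → ℕ := fun n => tailStart n (x n * √n) with ha_def
  have hau : ∀ n : ℕ, 0 < n → (a n : ℝ) = n * ((1 + u n) / 2) := by
    intro n hn
    have hn' : (0 : ℝ) < n := by exact_mod_cast hn
    simp only [hu_def, ha_def, tailOffset]
    field_simp
    ring
  have hu1 : ∀ᶠ n in atTop, u n < 1 := hu.eventually_lt_const one_pos
  have hlt : ∀ᶠ n in atTop, a n < n := by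
    filter_upwards [hu1, eventually_gt_atTop 0] with n hn hn0
    have hn' : (0 : ℝ) < n := by exact_mod_cast hn0
    have : (a n : ℝ) < n := by rw [hau n hn0]; nlinarith
    exact_mod_cast this
  have hta : Tendsto a atTop atTop := by
    rw [← tendsto_natCast_atTop_iff (R := ℝ)]
    have : Tendsto (fun n : ℕ => (n : ℝ) * ((1 + u n) / 2)) atTop atTop :=
      tendsto_natCast_atTop_atTop.atTop_mul_pos (C := 1 / 2) (by norm_num)
        (by simpa using (hu.const_add 1).div_const 2)
    exact this.congr' (by filter_upwards [eventually_gt_atTop 0] with n hn using (hau n hn).symm)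
  have htb : Tendsto (fun n => n - a n) atTop atTop := by
    rw [← tendsto_natCast_atTop_iff (R := ℝ)]
    have : Tendsto (fun n : ℕ => (n : ℝ) * ((1 - u n) / 2)) atTop atTop :=
      tendsto_natCast_atTop_atTop.atTop_mul_pos (C := 1 / 2) (by norm_num)
        (by simpa using (hu.const_sub 1).div_const 2)
    refine this.congr' ?_
    filter_upwards [eventually_gt_atTop 0, hlt] with n hn hl
    rw [Nat.cast_sub hl.le, hau n hn]
    ring
  have hst := Stirling.tendsto_stirlingSeq_sqrt_pi
  have hpi : √Real.pi ≠ 0 := by positivity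
  have hlim : Tendsto (fun n => Stirling.stirlingSeq n /
      (Stirling.stirlingSeq (a n) * Stirling.stirlingSeq (n - a n)) * √(2 / (1 - u n ^ 2)))
      atTop (𝓝 (√Real.pi / (√Real.pi * √Real.pi) * √(2 / (1 - 0 ^ 2)))) := by
    refine (hst.div ((hst.comp hta).mul (hst.comp htb)) (mul_ne_zero hpi hpi)).mul ?_
    exact (tendsto_const_nhds.div ((hu.pow 2).const_sub 1) (by norm_num)).sqrt
  have e : √Real.pi / (√Real.pi * √Real.pi) * √(2 / (1 - 0 ^ 2)) = √2 / √Real.pi := by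
    norm_num
    field_simp
  rw [e] at hlim
  refine hlim.congr' ?_
  filter_upwards [hlt, eventually_gt_atTop 0, hu1, hta.eventually_gt_atTop 0] with n hl hn hu1 ha0
  have hn' : (0 : ℝ) < n := by exact_mod_cast hn
  have hu0 : 0 < u n := div_pos (tailOffset_pos hx n) hn'
  have hc := choose_div_eq ha0 (Nat.sub_pos_of_lt hl)
  have hcast : ((n - a n : ℕ) : ℝ) = n * ((1 - u n) / 2) := by
    rw [Nat.cast_sub hl.le, hau n hn]; ring
  rw [Nat.add_sub_cancel' hl.le, hcast] at hc
  have hau' := hau n hn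
  have e1 : ((a n : ℝ) - n * ((1 - u n) / 2)) / n = u n := by rw [hau']; field_simp; ring
  have hpos : 0 < 1 - u n ^ 2 := by nlinarith
  -- The Stirling prefactor, using `a = n (1 + u) / 2` and `n - a = n (1 - u) / 2`.
  have e2 : √((n : ℝ) / (2 * a n * (n * ((1 - u n) / 2)))) * √n = √(2 / (1 - u n ^ 2)) := by
    rw [← Real.sqrt_mul' _ hn'.le, hau']
    congr 1
    have h1 : 0 < 1 + u n := by linarith
    have h2 : 0 < 1 - u n := by linarith
    rw [show 1 - u n ^ 2 = (1 + u n) * (1 - u n) by ring]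
    field_simp
  rw [e1] at hc
  change _ = headWeight x n * √n * Real.exp (n * rateFun (u n))
  rw [headWeight, hc, ← e2, Real.exp_neg]
  field_simp

/-- Makes both the isolated term `1` of `sum_exp_le` and the loss `2 / √n` from `mills_sub_le`
negligible. Since `mills x` is at least of order `1 / (x + 1)`, this is where `x = o(√n)` enters. -/
lemma tendsto_inv_sqrt_mul_mills (hx : ∀ n, 0 ≤ x n)
    (h : Tendsto (fun n => x n / √n) atTop (𝓝 0)) :
    Tendsto (fun n : ℕ => 2 / (√n * mills (x n))) atTop (𝓝 0) := by
  have hs : Tendsto (fun n : ℕ => 1 / √(n : ℝ)) atTop (𝓝 0) :=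
    tendsto_const_nhds.div_atTop (Real.tendsto_sqrt_atTop.comp tendsto_natCast_atTop_atTop)
  have h2 : Tendsto (fun n : ℕ => 2 * Real.exp 2 * (x n / √n + 1 / √n)) atTop (𝓝 0) := by
    simpa using (h.add hs).const_mul (2 * Real.exp 2)
  refine tendsto_of_tendsto_of_tendsto_of_le_of_le' tendsto_const_nhds h2 ?_ ?_
  · refine Eventually.of_forall fun n => ?_
    have := mills_pos (hx n)
    positivity
  · filter_upwards [eventually_gt_atTop 0] with n hn
    have hsn : 0 < √(n : ℝ) := Real.sqrt_pos.mpr (by exact_mod_cast hn)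
    have hx1 : 0 < x n + 1 := by linarith [hx n]
    have h3 : 2 / (√n * mills (x n)) ≤ 2 / (√n * (Real.exp (-2) / (x n + 1))) := by
      gcongr
      exact mills_ge (hx n)
    refine h3.trans_eq ?_
    rw [Real.exp_neg]
    field_simp

lemma exists_window : ∃ N : ℕ → ℕ, (∀ n, 0 < n → 0 < N n) ∧
    Tendsto (fun n => (N n : ℝ) / n) atTop (𝓝 0) ∧
    Tendsto (fun n : ℕ => 2 / (n : ℝ) * (N n : ℝ) ^ 2) atTop atTop := by
  -- Any scale strictly between `√n` and `n` works: wide enough to capture the Gaussian mass, narrow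
  -- enough that `D / n → 1`.
  refine ⟨fun n => ⌈(n : ℝ) ^ (3 / 4 : ℝ)⌉₊, fun n hn => ?_, ?_, ?_⟩
  · have : (0 : ℝ) < n := by exact_mod_cast hn
    exact Nat.ceil_pos.mpr (by positivity)
  · have h1 : Tendsto (fun n : ℕ => (n : ℝ) ^ (-(1 / 4) : ℝ) + 1 / n) atTop (𝓝 0) := by
      simpa using ((tendsto_rpow_neg_atTop (by norm_num : (0 : ℝ) < 1 / 4)).comp
        tendsto_natCast_atTop_atTop).add (tendsto_const_div_atTop_nhds_zero_nat (1 : ℝ))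
    refine tendsto_of_tendsto_of_tendsto_of_le_of_le' tendsto_const_nhds h1
      (Eventually.of_forall fun n => by positivity) ?_
    filter_upwards [eventually_gt_atTop 0] with n hn
    have hn' : (0 : ℝ) < n := by exact_mod_cast hn
    have h2 := (Nat.ceil_lt_add_one (by positivity : 0 ≤ (n : ℝ) ^ (3 / 4 : ℝ))).le
    rw [div_le_iff₀ hn', add_mul, one_div_mul_cancel hn'.ne']
    have h3 : (n : ℝ) ^ (-(1 / 4) : ℝ) * n = (n : ℝ) ^ (3 / 4 : ℝ) := by
      rw [← Real.rpow_add_one hn'.ne']; norm_num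
    rw [h3]
    exact h2
  · have h1 : Tendsto (fun n : ℕ => 2 * (n : ℝ) ^ (1 / 2 : ℝ)) atTop atTop :=
      ((tendsto_rpow_atTop (by norm_num)).comp tendsto_natCast_atTop_atTop).const_mul_atTop
        (by norm_num)
    refine tendsto_atTop_mono' _ ?_ h1
    filter_upwards [eventually_gt_atTop 0] with n hn
    have hn' : (0 : ℝ) < n := by exact_mod_cast hn
    have h2 := Nat.le_ceil ((n : ℝ) ^ (3 / 4 : ℝ))
    have h3 : (n : ℝ) ^ (1 / 2 : ℝ) * n = ((n : ℝ) ^ (3 / 4 : ℝ)) ^ 2 := by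
      rw [← Real.rpow_add_one hn'.ne', ← Real.rpow_mul_natCast hn'.le]; norm_num
    rw [div_mul_eq_mul_div, le_div_iff₀ hn', mul_assoc, h3]
    gcongr

lemma tendsto_binomTail_div_headWeight (hx : ∀ n, 0 ≤ x n)
    (h : Tendsto (fun n => x n / √n) atTop (𝓝 0)) :
    Tendsto (fun n : ℕ => binomTail n (x n * √n) / (headWeight x n * (√n / 2 * mills (x n))))
      atTop (𝓝 1) := by
  have hu := tendsto_tailOffset_div hx h
  have hm := tendsto_inv_sqrt_mul_mills hx h
  have hone : Tendsto (fun n : ℕ => (1 : ℝ) / n) atTop (𝓝 0) :=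
    tendsto_const_div_atTop_nhds_zero_nat 1
  obtain ⟨N, hN0, hN1, hN2⟩ := exists_window
  have hup : Tendsto (fun n : ℕ => 2 / (√n * mills (x n)) + (1 + 1 / (n : ℝ))) atTop (𝓝 1) := by
    simpa using hm.add (hone.const_add 1)
  have hD : Tendsto (fun n : ℕ => 1 + 1 / (n : ℝ) - (tailOffset x n / n + 2 * (N n / n)))
      atTop (𝓝 1) := by
    simpa using (hone.const_add 1).sub (hu.add (hN1.const_mul 2))
  have hlow : Tendsto (fun n : ℕ => (1 - Real.exp (-(2 / n * (N n : ℝ) ^ 2))) *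
      ((1 + 1 / (n : ℝ) - (tailOffset x n / n + 2 * (N n / n))) *
        (1 - 2 / (√n * mills (x n))))) atTop (𝓝 1) := by
    simpa using ((Real.tendsto_exp_neg_atTop_nhds_zero.comp hN2).const_sub 1).mul
      (hD.mul (hm.const_sub 1))
  have hDpos := hD.eventually_const_lt zero_lt_one
  refine tendsto_of_tendsto_of_tendsto_of_le_of_le' hlow hup ?_ ?_
  · filter_upwards [eventually_gt_atTop 0, hDpos] with n hn hDn
    have hn' : (0 : ℝ) < n := by exact_mod_cast hn
    have hsn : 0 < √(n : ℝ) := Real.sqrt_pos.mpr hn'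
    have hmp := mills_pos (hx n)
    have hDeq : 1 + 1 / (n : ℝ) - (tailOffset x n / n + 2 * (N n / n)) =
        (n + 1 - (tailOffset x n + 2 * N n)) / n := by field_simp
    rw [hDeq] at hDn ⊢
    set D : ℝ := n + 1 - (tailOffset x n + 2 * N n) with hDdef
    have hD0 : 0 < D := by
      by_contra hneg
      exact absurd hDn (not_lt.mpr (div_nonpos_of_nonpos_of_nonneg (not_lt.mp hneg) hn'.le))
    have hb := le_binomTail hn (hN0 n hn) (hx n) (k := tailOffset x n) rfl hDdef hD0
    have hhead : 0 < headWeight x n := by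
      have : tailStart n (x n * √n) ≤ n := by
        have h1 : (1 : ℝ) ≤ N n := by exact_mod_cast hN0 n hn
        have h2 : (tailStart n (x n * √n) : ℝ) < n := by
          have : tailOffset x n = 2 * (tailStart n (x n * √n) : ℝ) - n := rfl
          linarith
        exact_mod_cast h2.le
      have := Nat.choose_pos this
      have : (0 : ℝ) < n.choose (tailStart n (x n * √n)) := by exact_mod_cast this
      exact div_pos this (by positivity)
    have hmk : mills (x n) - 2 / √n ≤ mills (tailOffset x n / √n) := by
      refine (mills_sub_le (hx n) (by positivity)).trans (mills_anti ?_ ?_)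
      · exact div_nonneg (tailOffset_pos hx n).le hsn.le
      · rw [div_le_iff₀ hsn, add_mul, div_mul_cancel₀ _ hsn.ne']
        exact tailOffset_le hx n
    rw [le_div_iff₀ (by positivity)]
    refine le_trans ?_ hb
    have hE : 0 ≤ 1 - Real.exp (-(2 / n * (N n : ℝ) ^ 2)) := by
      rw [sub_nonneg, Real.exp_le_one_iff, neg_nonpos]; positivity
    set E := 1 - Real.exp (-(2 / n * (N n : ℝ) ^ 2))
    calc E * (D / n * (1 - 2 / (√n * mills (x n)))) * (headWeight x n * (√n / 2 * mills (x n)))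
        = headWeight x n * (E * (D / (2 * √n) * (mills (x n) - 2 / √n))) := by
          have : (n : ℝ) = √n * √n := (Real.mul_self_sqrt hn'.le).symm
          rw [this, Real.sqrt_mul_self hsn.le]
          field_simp
      _ ≤ headWeight x n * (E * (D / (2 * √n) * mills (tailOffset x n / √n))) := by gcongr
      _ = _ := rfl
  · filter_upwards [eventually_gt_atTop 0] with n hn
    have hn' : (0 : ℝ) < n := by exact_mod_cast hn
    have hsn : 0 < √(n : ℝ) := Real.sqrt_pos.mpr hn'
    have hmp := mills_pos (hx n)
    have hb := binomTail_le hn (hx n) (k := tailOffset x n) rfl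
    have hhead : 0 ≤ headWeight x n := by unfold headWeight; positivity
    refine div_le_of_le_mul₀ (by positivity) (by positivity) (hb.trans_eq ?_)
    change headWeight x n * _ = _
    have : (n : ℝ) = √n * √n := (Real.mul_self_sqrt hn'.le).symm
    rw [this, Real.sqrt_mul_self hsn.le]
    field_simp

/-- Cramér-type asymptotics of `binomRatio` in the moderate deviation range. -/
lemma tendsto_binomRatio_mul_exp (hx : ∀ n, 0 ≤ x n)
    (h : Tendsto (fun n => x n / √n) atTop (𝓝 0)) :
    Tendsto (fun n : ℕ => binomRatio n (x n) *
      Real.exp (n * rateFun (tailOffset x n / n) - x n ^ 2 / 2)) atTop (𝓝 1) := by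
  have h1 := tendsto_headWeight hx h
  have h2 := tendsto_binomTail_div_headWeight hx h
  have h3 := (h2.mul h1).mul_const (√(2 * Real.pi) / 2)
  have e : 1 * (√2 / √Real.pi) * (√(2 * Real.pi) / 2) = 1 := by
    rw [Real.sqrt_mul (by norm_num)]
    have : √(2 : ℝ) * √2 = 2 := Real.mul_self_sqrt (by norm_num)
    field_simp
    linarith
  rw [e] at h3
  refine h3.congr' ?_
  have hne : ∀ᶠ n : ℕ in atTop, headWeight x n * √n *
      Real.exp (n * rateFun (tailOffset x n / n)) ≠ 0 := h1.eventually_ne (by positivity)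
  filter_upwards [eventually_gt_atTop 0, hne] with n hn hne
  have hn' : (0 : ℝ) < n := by exact_mod_cast hn
  have hsn : 0 < √(n : ℝ) := Real.sqrt_pos.mpr hn'
  have hmp := mills_pos (hx n)
  have hh : headWeight x n ≠ 0 := fun h0 => hne (by rw [h0]; ring)
  rw [binomRatio, one_sub_stdNormalCDF, sub_eq_add_neg, Real.exp_add]
  have hpi : 0 < √(2 * Real.pi) := by positivity
  field_simp

/-- With `u = k / n` and `t = x / √n`, the bound `u - t ≤ 2 / n` gives `n (u² - t²) ≤ 2 (u + t) →
0`, so `u` may be replaced by `t`. -/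
lemma exists_rate_expansion (hx : ∀ n, 0 ≤ x n) (h : Tendsto (fun n => x n / √n) atTop (𝓝 0)) :
    ∃ ε : ℕ → ℝ, Tendsto ε atTop (𝓝 0) ∧ Tendsto (fun n : ℕ =>
      n * rateFun (tailOffset x n / n) - x n ^ 2 / 2 - x n ^ 4 / (12 * (n : ℝ)) * (1 + ε n))
      atTop (𝓝 0) := by
  have hu := tendsto_tailOffset_div hx h
  set u : ℕ → ℝ := fun n => tailOffset x n / n with hu_def
  set t : ℕ → ℝ := fun n => x n / √n with ht_def
  -- The exact relative error of the quartic term at `u`. For small `u` it lies in `[0, u²]`; the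
  -- division is legitimate for `n > 0` because `k > x √n` strictly.
  set ε : ℕ → ℝ := fun n => (rateFun (u n) - u n ^ 2 / 2) / (u n ^ 4 / 12) - 1 with hε_def
  have hu0 : ∀ n, 0 < n → 0 < u n := fun n hn =>
    div_pos (tailOffset_pos hx n) (by exact_mod_cast hn)
  have hε : Tendsto ε atTop (𝓝 0) := by
    have hu2 : Tendsto (fun n => u n ^ 2) atTop (𝓝 0) := by simpa using hu.pow 2
    refine tendsto_of_tendsto_of_tendsto_of_le_of_le' tendsto_const_nhds hu2 ?_ ?_
    · filter_upwards [eventually_gt_atTop 0, hu.eventually_lt_const one_pos] with n hn hn1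
      have := hu0 n hn
      have := rateFun_ge (hu0 n hn).le hn1.le
      rw [hε_def, sub_nonneg, le_div_iff₀ (by positivity)]
      linarith
    · filter_upwards [eventually_gt_atTop 0,
        hu.eventually_lt_const (by norm_num : (0 : ℝ) < 1 / 2)] with n hn hn1
      have := hu0 n hn
      have := rateFun_le (hu0 n hn).le hn1.le
      rw [hε_def, sub_le_iff_le_add, div_le_iff₀ (by positivity)]
      nlinarith
  refine ⟨ε, hε, ?_⟩
  have hsq : Tendsto (fun n : ℕ => n * (u n ^ 2 - t n ^ 2)) atTop (𝓝 0) := by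
    have hlim : Tendsto (fun n : ℕ => 2 * (u n + t n)) atTop (𝓝 0) := by
      simpa using (hu.add h).const_mul 2
    refine tendsto_of_tendsto_of_tendsto_of_le_of_le' tendsto_const_nhds hlim ?_ ?_ <;>
      filter_upwards [eventually_gt_atTop 0] with n hn <;>
      obtain ⟨h1, h2⟩ := div_sqrt_le_tailOffset_div hx hn <;>
      have hn' : (0 : ℝ) < n := by exact_mod_cast hn
    · have ht0 : 0 ≤ t n := div_nonneg (hx n) (Real.sqrt_nonneg _)
      exact mul_nonneg hn'.le (sub_nonneg.mpr (pow_le_pow_left₀ ht0 h1 2))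
    · have ht0 : 0 ≤ t n := div_nonneg (hx n) (Real.sqrt_nonneg _)
      have h3 : n * (u n - t n) ≤ 2 := by
        have : u n - t n ≤ 2 / n := by simp only [hu_def, ht_def]; linarith
        rw [le_div_iff₀ hn'] at this
        linarith
      have := mul_le_mul_of_nonneg_right h3 (add_nonneg (hu0 n hn).le ht0)
      linarith
  have hfour : Tendsto (fun n : ℕ => n * (u n ^ 2 - t n ^ 2) * (u n ^ 2 + t n ^ 2))
      atTop (𝓝 0) := by
    simpa using hsq.mul ((hu.pow 2).add (h.pow 2))
  have hlim : Tendsto (fun n : ℕ => n * (u n ^ 2 - t n ^ 2) / 2 +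
      n * (u n ^ 2 - t n ^ 2) * (u n ^ 2 + t n ^ 2) / 12 * (1 + ε n)) atTop (𝓝 0) := by
    simpa using (hsq.div_const 2).add ((hfour.div_const 12).mul (hε.const_add 1))
  refine hlim.congr' ?_
  filter_upwards [eventually_gt_atTop 0] with n hn
  have hn' : (0 : ℝ) < n := by exact_mod_cast hn
  have hun := hu0 n hn
  have e1 : rateFun (u n) = u n ^ 2 / 2 + u n ^ 4 / 12 * (1 + ε n) := by
    simp only [hε_def]
    field_simp
    ring
  have e2 : x n ^ 2 = n * t n ^ 2 := by
    simp only [ht_def, div_pow, Real.sq_sqrt hn'.le]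
    field_simp
  have e3 : x n ^ 4 / (12 * (n : ℝ)) = n * t n ^ 4 / 12 := by
    rw [show x n ^ 4 = (x n ^ 2) ^ 2 by ring, e2]
    field_simp
  change _ = n * rateFun (u n) - x n ^ 2 / 2 - x n ^ 4 / (12 * (n : ℝ)) * (1 + ε n)
  rw [e1, e2, e3]
  ring

theorem binomRatio_expansion (hx : ∀ n, 0 ≤ x n)
    (h : Tendsto (fun n => x n / √n) atTop (𝓝 0)) :
    ∃ ε δ : ℕ → ℝ, Tendsto ε atTop (𝓝 0) ∧ Tendsto δ atTop (𝓝 0) ∧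
      ∀ n : ℕ, binomRatio n (x n) =
        Real.exp (-(x n ^ 4 / (12 * (n : ℝ)) * (1 + ε n))) * (1 + δ n) := by
  obtain ⟨ε, hε, hγ⟩ := exists_rate_expansion hx h
  -- `δ` is chosen to make the identity exact for every `n`; the content is that `δ → 0`.
  refine ⟨ε, fun n => binomRatio n (x n) *
    Real.exp (x n ^ 4 / (12 * (n : ℝ)) * (1 + ε n)) - 1, hε, ?_, fun n => ?_⟩
  · have h1 := (tendsto_binomRatio_mul_exp hx h).mul
      ((Real.continuous_exp.tendsto _).comp hγ.neg)
    simp only [neg_zero, Real.exp_zero, mul_one] at h1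
    rw [← sub_self 1]
    refine (h1.congr fun n => ?_).sub_const 1
    rw [Function.comp_apply, mul_assoc, ← Real.exp_add]
    congr 2
    ring
  · rw [add_sub_cancel, mul_left_comm, ← Real.exp_add, neg_add_cancel, Real.exp_zero, mul_one]

lemma isLittleO_sqrt_iff :
    x =o[atTop] (fun n : ℕ => (n : ℝ) ^ (1 / 2 : ℝ)) ↔
      Tendsto (fun n => x n / √n) atTop (𝓝 0) := by
  rw [isLittleO_iff_tendsto' ?_]
  · simp only [Real.sqrt_eq_rpow]
  · filter_upwards [eventually_gt_atTop 0] with n hn h0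
    have hn' : (0 : ℝ) < n := by exact_mod_cast hn
    exact absurd h0 (by positivity)

lemma isLittleO_fourth_root_iff (hx : ∀ n, 0 ≤ x n) :
    x =o[atTop] (fun n : ℕ => (n : ℝ) ^ (1 / 4 : ℝ)) ↔
      Tendsto (fun n => x n ^ 4 / n) atTop (𝓝 0) := by
  have e : ∀ n : ℕ, (x n / (n : ℝ) ^ (1 / 4 : ℝ)) ^ 4 = x n ^ 4 / n := by
    intro n
    rw [div_pow, ← Real.rpow_mul_natCast (Nat.cast_nonneg n)]
    norm_num
  rw [isLittleO_iff_tendsto' ?_]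
  · constructor
    · intro h
      have := h.pow 4
      simp only [e] at this
      simpa using this
    · intro h
      have := h.sqrt.sqrt
      simp only [Real.sqrt_zero] at this
      refine this.congr fun n => ?_
      have hnn : 0 ≤ x n / (n : ℝ) ^ (1 / 4 : ℝ) := div_nonneg (hx n) (by positivity)
      rw [← e, show (x n / (n : ℝ) ^ (1 / 4 : ℝ)) ^ 4 = ((x n / (n : ℝ) ^ (1 / 4 : ℝ)) ^ 2) ^ 2
        by ring, Real.sqrt_sq (by positivity), Real.sqrt_sq hnn]
  · filter_upwards [eventually_gt_atTop 0] with n hn h0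
    have hn' : (0 : ℝ) < n := by exact_mod_cast hn
    exact absurd h0 (by positivity)

theorem tendsto_binomRatio_iff (hx : ∀ n, 0 ≤ x n) :
    Tendsto (fun n => binomRatio n (x n)) atTop (𝓝 1) ↔
      x =o[atTop] (fun n : ℕ => (n : ℝ) ^ (1 / 4 : ℝ)) := by
  rw [isLittleO_fourth_root_iff hx]
  constructor
  · intro h
    obtain ⟨ε, δ, hε, hδ, heq⟩ := binomRatio_expansion hx (tendsto_div_sqrt_of_binomRatio hx h)
    have hδ1 : Tendsto (fun n => 1 + δ n) atTop (𝓝 1) := by simpa using hδ.const_add 1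
    have hε1 : Tendsto (fun n => 1 + ε n) atTop (𝓝 1) := by simpa using hε.const_add 1
    -- Taking logarithms of the expansion gives `x⁴ / (12 n) * (1 + ε) → 0`; dividing by `1 + ε` and
    -- multiplying by `-12` isolates `x⁴ / n`.
    have h1 := (h.div hδ1 one_ne_zero).log (by norm_num)
    simp only [div_one, Real.log_one] at h1
    have h2 := (h1.div hε1 one_ne_zero).const_mul (-12)
    simp only [div_one, mul_zero] at h2
    refine h2.congr' ?_
    filter_upwards [hδ1.eventually_ne one_ne_zero, hε1.eventually_ne one_ne_zero] with n hn1 hn2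
    simp only [Pi.div_apply]
    rw [heq, mul_div_cancel_right₀ _ hn1, Real.log_exp, neg_div, mul_div_cancel_right₀ _ hn2,
      div_mul_eq_div_div_swap]
    ring
  · intro h
    have hroot : Tendsto (fun n => x n / √n) atTop (𝓝 0) := by
      refine isLittleO_sqrt_iff.mp (((isLittleO_fourth_root_iff hx).mpr h).trans_isBigO ?_)
      refine IsBigO.of_bound 1 ?_
      filter_upwards [eventually_gt_atTop 0] with n hn
      have hn' : (1 : ℝ) ≤ n := by exact_mod_cast hn
      rw [one_mul, Real.norm_of_nonneg (by positivity), Real.norm_of_nonneg (by positivity)]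
      exact Real.rpow_le_rpow_of_exponent_le hn' (by norm_num)
    obtain ⟨ε, δ, hε, hδ, heq⟩ := binomRatio_expansion hx hroot
    have h1 : Tendsto (fun n => x n ^ 4 / n / 12 * (1 + ε n)) atTop (𝓝 0) := by
      simpa using (h.div_const 12).mul (hε.const_add 1)
    have h2 := ((Real.continuous_exp.tendsto _).comp h1.neg).mul (hδ.const_add 1)
    simp only [neg_zero, Real.exp_zero, add_zero, mul_one] at h2
    refine h2.congr fun n => ?_
    rw [heq, Function.comp_apply, div_div, mul_comm (n : ℝ) 12]

end Asymptotics

/-! ### Transfer to self-normalized sums -/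

theorem upperTailRatio_asymptotics {Ω : Type*} [MeasurableSpace Ω] {P : Measure Ω}
    [IsProbabilityMeasure P] {X : ℕ → Ω → ℝ} (hRad : ∀ i, IsRademacher (X i) P)
    (hInd : iIndepFun X P) {x : ℕ → ℝ} (hx : ∀ n, 0 ≤ x n) :
    (x =o[atTop] (fun n : ℕ => (n : ℝ) ^ (1 / 2 : ℝ)) →
      ∃ ε δ : ℕ → ℝ, Tendsto ε atTop (𝓝 0) ∧ Tendsto δ atTop (𝓝 0) ∧
        ∀ n : ℕ, 1 ≤ n → upperTailRatio X P n (x n) =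
          Real.exp (-(x n ^ 4 / (12 * (n : ℝ)) * (1 + ε n))) * (1 + δ n)) ∧
    (Tendsto (fun n => upperTailRatio X P n (x n)) atTop (𝓝 1) ↔
      x =o[atTop] (fun n : ℕ => (n : ℝ) ^ (1 / 4 : ℝ))) := by
  have e : ∀ n, 1 ≤ n → upperTailRatio X P n (x n) = binomRatio n (x n) := fun n hn =>
    upperTailRatio_eq hRad hInd hn (x n)
  constructor
  · intro h
    obtain ⟨ε, δ, hε, hδ, heq⟩ := binomRatio_expansion hx (isLittleO_sqrt_iff.mp h)
    exact ⟨ε, δ, hε, hδ, fun n hn => (e n hn).trans (heq n)⟩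
  · rw [← tendsto_binomRatio_iff hx]
    refine tendsto_congr' ?_
    filter_upwards [eventually_ge_atTop 1] with n hn using e n hn

theorem mainTheorem9 {Ω : Type*} [MeasurableSpace Ω] (P : Measure Ω) [IsProbabilityMeasure P]
    (X : ℕ → Ω → ℝ) (hRad : ∀ i, IsRademacher (X i) P) (hInd : iIndepFun X P)
    (x : ℕ → ℝ) (hx : ∀ n, 0 ≤ x n) :
    (x =o[atTop] (fun n : ℕ => (n : ℝ) ^ (1 / 2 : ℝ)) →
      (∃ ε δ : ℕ → ℝ, Tendsto ε atTop (𝓝 0) ∧ Tendsto δ atTop (𝓝 0) ∧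
        ∀ n : ℕ, 1 ≤ n → upperTailRatio X P n (x n) =
          Real.exp (-(x n ^ 4 / (12 * (n : ℝ)) * (1 + ε n))) * (1 + δ n)) ∧
      (∃ ε δ : ℕ → ℝ, Tendsto ε atTop (𝓝 0) ∧ Tendsto δ atTop (𝓝 0) ∧
        ∀ n : ℕ, 1 ≤ n → lowerTailRatio X P n (x n) =
          Real.exp (-(x n ^ 4 / (12 * (n : ℝ)) * (1 + ε n))) * (1 + δ n))) ∧
    (SelfNormalizedModerateDeviation X P x ↔
      x =o[atTop] (fun n : ℕ => (n : ℝ) ^ (1 / 4 : ℝ))) ∧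
    (Tendsto (fun n => upperTailRatio X P n (x n)) atTop (𝓝 1) ↔
      x =o[atTop] (fun n : ℕ => (n : ℝ) ^ (1 / 4 : ℝ))) ∧
    (Tendsto (fun n => lowerTailRatio X P n (x n)) atTop (𝓝 1) ↔
      x =o[atTop] (fun n : ℕ => (n : ℝ) ^ (1 / 4 : ℝ))) := by
  have hIndNeg : iIndepFun (fun i ω => -X i ω) P :=
    hInd.comp (fun _ y => -y) fun _ => measurable_neg
  have hU := upperTailRatio_asymptotics hRad hInd hx
  have hL := upperTailRatio_asymptotics (fun i => (hRad i).neg) hIndNeg hx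
  simp only [← lowerTailRatio_eq] at hL
  refine ⟨fun h => ⟨hU.1 h, hL.1 h⟩, ⟨fun h => hU.2.mp h.1, fun h => ⟨hU.2.mpr h, hL.2.mpr h⟩⟩,
    hU.2, hL.2⟩
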